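/- Let $n\ge 1$, let $\tau>0$ be real, and let $\alpha\in\mathbb C$ satisfy $i+j\tau+2\alpha\ne0$ for all integers $i\ge1$, $j\ge0$. Let $\lambda=(\lambda_1\ge\dots\ge\lambda_n\ge0)$ be a partition of length at most $n$, with weight $|\lambda|=\lambda_1+\dots+\lambda_n$ and conjugate partition $\lambda'$ (so $\lambda'_j=\#\{i:\lambda_i\ge j\}$), and let $\delta=(n-1,n-2,\dots,1,0)$. Write $(z)_k=z(z+1)\cdots(z+k-1)$. For $0<q,t<1$ and $a\in\mathbb C\setminus\{0\}$ the $BC_n$-type interpolation Macdonald polynomial $P_\lambda^{\rm ip}(x;q,t,a)$ is the unique (for generic $a$) Laurent polynomial in $x=(x_1,\dots,x_n)$ with complex coefficients which is invariant under permutations of the variables and under the inversions $x_i\mapsto x_i^{-1}$, which has degree $|\lambda|$ (the highest value of $m_1+\dots+m_n$ for a monomial $x^m$ occurring in it), in which $x^\lambda$ has coefficient $1$, and which vanishes at the point $(q^{\mu_i}t^{n-i}a)_{i=1}^n$ for each partition $\mu$ of length at most $n$ that does not contain $\lambda$ (that is, $\lambda_i>\mu_i$ for some $i$). The $BC_n$-type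 interpolation Jack polynomial is $$P_\lambda^{\rm ip}(x;\tau,\alpha):=\lim_{q\uparrow1}(1-q)^{-2|\lambda|}\,P_\lambda^{\rm ip}(q^{x_1},\dots,q^{x_n};q,q^\tau,q^\alpha).$$ Then, for all $q<1$ close enough to $1$, there is exactly one Laurent polynomial with the defining properties of $P_\lambda^{\rm ip}(x;q,q^\tau,q^\alpha)$; the limit exists at the point $x=\lambda+\tau\delta+\alpha=(\lambda_i+\tau(n-i)+\alpha)_{i=1}^n$; and $$P_\lambda^{\rm ip}(\lambda+\tau\delta+\alpha;\tau,\alpha)=\prod_{i=1}^n\prod_{j=1}^{\lambda_i}\bigl(\lambda_i-j+1+\tau(\lambda'_j-i)\bigr)\bigl(2\alpha+\lambda_i+j-1+\tau(\lambda'_j-i+2(n-\lambda'_j))\bigr).$$ Moreover, whenever no denominator below vanishes, this value is also equal to $$\prod_{j=1}^n\frac{((n-j)\tau+1)_{\lambda_j}\,(2(n-j)\tau+2\alpha)_{2\lambda_j}}{((n-j)\tau+2\alpha)_{\lambda_j}}\;\prod_{1\le i<j\le n}\frac{((2n-i-j)\tau+2\alpha)_{\lambda_i+\lambda_j}}{((2n-i-j+1)\tau+2\alpha)_{\lambda_i+\lambda_j}}\,\frac{((j-i-1)\tau+1)_{\lambda_i-\lambda_j}}{((j-i)\tau+1)_{\lambda_i-\lambda_j}}.$$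 -/

import Mathlib

open Filter Topology

namespace BCInterpolation

/-- Complex Laurent polynomials in `n` variables, with exponent vectors in `ℤⁿ`. -/
abbrev Laurent (n : ℕ) : Type := AddMonoidAlgebra ℂ (Fin n → ℤ)

/-- The value of a Laurent polynomial at a point with nonzero coordinates. -/
noncomputable def Laurent.eval {n : ℕ} (x : Fin n → ℂ) (P : Laurent n) : ℂ :=
  P.coeff.sum fun m c => c * ∏ i, x i ^ m i

/-- Partitions of length at most `n`: weakly decreasing vectors of `n` natural numbers. -/
def IsPartition {n : ℕ} (lam : Fin n → ℕ) : Prop := Antitone lam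

/-- The weight `|λ|`. -/
def weight {n : ℕ} (lam : Fin n → ℕ) : ℕ := ∑ i, lam i

/-- The part `λ'_j` (`j ≥ 1`) of the conjugate partition: the number of rows of length `≥ j`. -/
def conjPart {n : ℕ} (lam : Fin n → ℕ) (j : ℕ) : ℕ :=
  (Finset.univ.filter fun i => j ≤ lam i).card

/-- `δ = (n-1, n-2, …, 1, 0)`; here `i` counts from `0`. -/
def delta (n : ℕ) (i : Fin n) : ℕ := n - 1 - (i : ℕ)

/-- Invariance under `W_n = S_n ⋉ (ℤ/2)ⁿ`, generated by the permutations of the variables and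
the inversions `x_i ↦ x_i⁻¹` of a single variable. -/
def Laurent.IsWInvariant {n : ℕ} (P : Laurent n) : Prop :=
  (∀ (s : Equiv.Perm (Fin n)) (m : Fin n → ℤ), P.coeff (m ∘ s) = P.coeff m) ∧
  (∀ (i : Fin n) (m : Fin n → ℤ), P.coeff (Function.update m i (-m i)) = P.coeff m)

/-- The highest degree `m_1 + ⋯ + m_n` of a monomial `x^m` occurring in `P` equals `d`. -/
def Laurent.HasDegree {n : ℕ} (P : Laurent n) (d : ℤ) : Prop :=
  IsGreatest ((fun m : Fin n → ℤ => ∑ i, m i) '' {m | P.coeff m ≠ 0}) d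

/-- The defining properties of the `BC_n`-type interpolation Macdonald polynomial
`P_λ^{ip}(x; q, t, a)`.  For a `W_n`-invariant Laurent polynomial the coefficient of the
symmetrized monomial of `λ` is its coefficient of `x^λ`. -/
structure IsInterpolationMacdonald {n : ℕ} (lam : Fin n → ℕ) (q t : ℝ) (a : ℂ)
    (P : Laurent n) : Prop where
  invariant : P.IsWInvariant
  degree : P.HasDegree (weight lam)
  monic : P.coeff (fun i => (lam i : ℤ)) = 1
  vanishing : ∀ mu : Fin n → ℕ, IsPartition mu → ¬ lam ≤ mu →
    P.eval (fun i => (q : ℂ) ^ mu i * (t : ℂ) ^ delta n i * a) = 0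

open Classical in
/-- The `BC_n`-type interpolation Macdonald polynomial: the unique Laurent polynomial with the
defining properties (and `0` for those parameters for which there is no such unique one). -/
noncomputable def interpolationMacdonald {n : ℕ} (lam : Fin n → ℕ) (q t : ℝ) (a : ℂ) :
    Laurent n :=
  if h : ∃! P : Laurent n, IsInterpolationMacdonald lam q t a P then h.choose else 0

/-- The expression `(1-q)^{-2|λ|} P_λ^{ip}(q^x; q, q^τ, q^α)`, with
`q^x = (q^{x_1}, …, q^{x_n})`. -/
noncomputable def rescaledMacdonald {n : ℕ} (lam : Fin n → ℕ) (tau : ℝ) (alpha : ℂ)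
    (x : Fin n → ℂ) (q : ℝ) : ℂ :=
  ((1 - (q : ℂ)) ^ (2 * weight lam))⁻¹ *
    (interpolationMacdonald lam q (q ^ tau) ((q : ℂ) ^ alpha)).eval (fun i => (q : ℂ) ^ x i)

/-- The `BC_n`-type interpolation Jack polynomial
`P_λ^{ip}(x; τ, α) = lim_{q ↑ 1} (1-q)^{-2|λ|} P_λ^{ip}(q^x; q, q^τ, q^α)`. -/
noncomputable def interpolationJack {n : ℕ} (lam : Fin n → ℕ) (tau : ℝ) (alpha : ℂ)
    (x : Fin n → ℂ) : ℂ :=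
  limUnder (𝓝[<] (1 : ℝ)) (rescaledMacdonald lam tau alpha x)

/-- The point `λ + τδ + α`. -/
noncomputable def spectralPoint {n : ℕ} (lam : Fin n → ℕ) (tau : ℝ) (alpha : ℂ) :
    Fin n → ℂ :=
  fun i => (lam i : ℂ) + (tau : ℂ) * (delta n i : ℂ) + alpha

/-- The Pochhammer symbol `(z)_k = z (z+1) ⋯ (z+k-1)`. -/
noncomputable def poch (z : ℂ) (k : ℕ) : ℂ := (ascPochhammer ℂ k).eval z

/-- The position `1, …, n` of an index, as a complex number. -/
noncomputable def pos {n : ℕ} (i : Fin n) : ℂ := ((i : ℕ) : ℂ) + 1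

end BCInterpolation

namespace BCInterpolation

open MvPolynomial

/-! ### Linear factors of multivariate polynomials -/

section Division

variable {σ : Type*}

/-! In the variables y_i = x_i + 1/x_i the invariant Laurent polynomials are exactly the symmetric
polynomials, with the same degree and the same top coefficients (`toLaurent`). So the object of
study is a symmetric f(y), evaluated on the grid x_i = q^{μ_i} t^{n-i} a. The grid is self-similar:
a last part 0 fixes x_n = a and leaves the grid in one variable fewer with base ta, while adding a
full column replaces a by qa. Moreover, if f vanishes on y_n = a + 1/a, then f is ∏ (y_i - a - 1/a)
times a symmetric g of smaller degree. Induction along these two moves shows that f of degree at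
most d is determined by its values at |μ| ≤ d (`eq_zero_of_gridEval_eq_zero`), and that if f has
degree at most |λ| and vanishes at all other μ with |μ| ≤ |λ|, its value at λ is its coefficient of
y^λ times a product over the boxes (`gridEval_eq_coeff_mul_boxProd`).

Counting dimensions gives a nonzero f vanishing at all μ ≠ λ with |μ| ≤ |λ|, but the definition
demands vanishing at every μ not containing λ. This extra vanishing (`gridEval_eq_zero_of_not_le`)
comes from a q-difference operator D that preserves symmetric polynomials of bounded degree and
whose value at μ involves f only at partitions obtained by removing a vertical strip from μ. A free
parameter u in D makes the diagonal coefficient zero at λ and nonzero at μ; then Df vanishes at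
enough points to be 0, and Df = 0 read at μ gives f(μ) = 0 by induction on |μ|. The operator needs a
slightly more generic base point; density and compactness remove that restriction
(`exists_vanishing`).

As q tends to 1, each box factor divided by (1-q)^2 tends to (A-B)(A+B), where A and B are the
exponents of q (`tendsto_invSum_cpow_sub`); this yields the box formula. The Pochhammer product
obeys the same two recursions, α ↦ α+τ for a zero part and α ↦ α+1 for a column, the latter by a
telescoping product (`pochProd_add_one`). -/

theorem X_sub_C_ne_zero (i : σ) (c : ℂ) : (X i - C c : MvPolynomial σ ℂ) ≠ 0 := by
  intro h
  simpa using congrArg (eval (fun _ => c + 1)) h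

theorem X_sub_X_ne_zero {i j : σ} (h : i ≠ j) : (X i - X j : MvPolynomial σ ℂ) ≠ 0 :=
  sub_ne_zero.mpr fun e => h (X_injective e)

variable [DecidableEq σ]

/-- Substitution of `p` for the variable `X i`. -/
noncomputable def subst (i : σ) (p : MvPolynomial σ ℂ) : MvPolynomial σ ℂ →ₐ[ℂ] MvPolynomial σ ℂ :=
  aeval (Function.update X i p)

theorem subst_X_self (i : σ) (p : MvPolynomial σ ℂ) : subst i p (X i) = p := by simp [subst]

theorem subst_X_of_ne {i j : σ} (h : j ≠ i) (p : MvPolynomial σ ℂ) : subst i p (X j) = X j := by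
  simp [subst, h]

/-- Modulo the ideal generated by X_i - p, the substitution is the identity on every variable, hence
on every polynomial. -/
theorem X_sub_dvd_sub_subst (i : σ) (p f : MvPolynomial σ ℂ) : X i - p ∣ f - subst i p f := by
  let I := Ideal.span {X i - p}
  have key : (Ideal.Quotient.mkₐ ℂ I) = (Ideal.Quotient.mkₐ ℂ I).comp (subst i p) := by
    apply MvPolynomial.algHom_ext
    intro j
    by_cases h : j = i
    · subst h
      simp only [AlgHom.comp_apply, subst_X_self, Ideal.Quotient.mkₐ_eq_mk]
      rw [Ideal.Quotient.eq]
      exact Ideal.mem_span_singleton_self _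
    · simp only [AlgHom.comp_apply, subst_X_of_ne h]
  have := DFunLike.congr_fun key f
  simp only [AlgHom.comp_apply, Ideal.Quotient.mkₐ_eq_mk] at this
  rw [Ideal.Quotient.eq] at this
  exact Ideal.mem_span_singleton.mp this

theorem X_sub_dvd_iff {i : σ} {p : MvPolynomial σ ℂ} (hp : subst i p p = p)
    (f : MvPolynomial σ ℂ) : X i - p ∣ f ↔ subst i p f = 0 := by
  constructor
  · rintro ⟨g, rfl⟩
    simp [subst_X_self, hp]
  · intro h
    simpa [h] using X_sub_dvd_sub_subst i p f

/-- By the factor theorem, divisibility by X_i - p is the vanishing of a ring homomorphism into a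
domain. The hypothesis `hp` says that p is not affected by the substitution. -/
theorem prime_X_sub {i : σ} {p : MvPolynomial σ ℂ} (hp : subst i p p = p) (h0 : X i - p ≠ 0) :
    Prime (X i - p) := by
  refine ⟨h0, ?_, ?_⟩
  · intro hu
    have : X i - p ∣ 1 := hu.dvd
    rw [X_sub_dvd_iff hp] at this
    simp at this
  · intro f g
    simp only [X_sub_dvd_iff hp, map_mul, mul_eq_zero]
    exact id

theorem subst_C (i : σ) (p : MvPolynomial σ ℂ) (c : ℂ) : subst i p (C c) = C c :=
  (subst i p).commutes c

theorem prod_X_sub_C_dvd [Fintype σ] (c : ℂ) (f : MvPolynomial σ ℂ) (h : ∀ i, X i - C c ∣ f) :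
    ∏ i, (X i - C c) ∣ f := by
  apply Finset.prod_dvd_of_isRelPrime _ fun i _ => h i
  intro i _ j _ hij
  rw [Function.onFun,
    (prime_X_sub (subst_C i _ c) (X_sub_C_ne_zero i c)).irreducible.isRelPrime_iff_not_dvd,
    X_sub_dvd_iff (subst_C i _ c)]
  simp [subst_X_of_ne hij.symm, X_sub_C_ne_zero]

end Division

/-- The Vandermonde product of the variables. -/
noncomputable def vdm (n : ℕ) : MvPolynomial (Fin n) ℂ := (Matrix.vandermonde X).det

theorem vdm_eq_prod (n : ℕ) :
    vdm n = ∏ p ∈ Finset.univ.filter (fun p : Fin n × Fin n => p.1 < p.2), (X p.2 - X p.1) := by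
  rw [vdm, Matrix.det_vandermonde, Finset.prod_filter, ← Finset.univ_product_univ,
    Finset.prod_product]
  refine Finset.prod_congr rfl fun i _ => ?_
  rw [← Finset.prod_filter]
  refine Finset.prod_congr ?_ fun _ _ => rfl
  ext j; simp

theorem vdm_ne_zero (n : ℕ) : vdm n ≠ 0 := by
  rw [vdm_eq_prod, Finset.prod_ne_zero_iff]
  intro p hp
  exact X_sub_X_ne_zero (Finset.mem_filter.mp hp).2.ne'

/-- The factors X_j - X_i are pairwise non-associated primes, so divisibility by each gives
divisibility by their product. -/
theorem vdm_dvd {n : ℕ} (f : MvPolynomial (Fin n) ℂ)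
    (h : ∀ i j, i < j → subst j (X i) f = 0) : vdm n ∣ f := by
  have hs : ∀ {i j : Fin n}, i < j → subst j (X i : MvPolynomial (Fin n) ℂ) (X i) = X i :=
    fun hij => subst_X_of_ne hij.ne _
  rw [vdm_eq_prod]
  apply Finset.prod_dvd_of_isRelPrime
  · rintro ⟨i, j⟩ hp ⟨k, l⟩ hq hne
    have hij : i < j := by simpa using hp
    have hkl : k < l := by simpa using hq
    rw [Function.onFun,
      (prime_X_sub (hs hij) (X_sub_X_ne_zero hij.ne')).irreducible.isRelPrime_iff_not_dvd,
      X_sub_dvd_iff (hs hij)]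
    have hX : ∀ k, subst j (X i : MvPolynomial (Fin n) ℂ) (X k) = X (if k = j then i else k) := by
      intro k
      split_ifs with hk
      · rw [hk, subst_X_self]
      · exact subst_X_of_ne hk _
    simp only [map_sub, hX]
    refine X_sub_X_ne_zero ?_
    intro e
    apply hne
    split_ifs at e <;> grind
  · rintro ⟨i, j⟩ hp
    have hij : i < j := by simpa using hp
    exact (X_sub_dvd_iff (hs hij) f).mpr (h i j hij)

/-! ### Total degree and top coefficients -/

section Degree

variable {σ : Type*}

theorem totalDegree_X_sub_C (i : σ) (c : ℂ) :
    (X i - C c : MvPolynomial σ ℂ).totalDegree = 1 := by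
  classical
  apply le_antisymm
  · exact (totalDegree_sub _ _).trans (by simp)
  · have : Finsupp.single i 1 ∈ (X i - C c : MvPolynomial σ ℂ).support := by
      have h0 : (0 : σ →₀ ℕ) ≠ Finsupp.single i 1 := fun h => by
        simpa using DFunLike.congr_fun h i
      simp [mem_support_iff, coeff_sub, coeff_C, coeff_X, h0]
    simpa using le_totalDegree this

theorem totalDegree_X_sub_X {i j : σ} (h : i ≠ j) :
    (X i - X j : MvPolynomial σ ℂ).totalDegree = 1 := by
  classical
  apply le_antisymm
  · exact (totalDegree_sub _ _).trans (by simp)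
  · have : Finsupp.single i 1 ∈ (X i - X j : MvPolynomial σ ℂ).support := by
      have h0 : Finsupp.single j 1 ≠ Finsupp.single i 1 := fun e =>
        h (Finsupp.single_left_injective one_ne_zero e).symm
      simp [mem_support_iff, coeff_sub, coeff_X, h0]
    simpa using le_totalDegree this

theorem totalDegree_prod_of_eq_one {ι : Type*} (s : Finset ι) (f : ι → MvPolynomial σ ℂ)
    (h : ∀ i ∈ s, (f i).totalDegree = 1) : (∏ i ∈ s, f i).totalDegree = s.card := by
  classical
  induction s using Finset.induction_on with
  | empty => simp
  | insert a s ha ih =>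
    have hne : ∀ i ∈ insert a s, f i ≠ 0 := fun i hi e => by simpa [e] using h i hi
    rw [Finset.prod_insert ha, totalDegree_mul_of_isDomain (hne a (by simp))
      (Finset.prod_ne_zero_iff.mpr fun i hi => hne i (by simp [hi])),
      h a (by simp), ih fun i hi => h i (by simp [hi]), Finset.card_insert_of_notMem ha, add_comm]

theorem totalDegree_aeval_le {τ : Type*} (g : σ → MvPolynomial τ ℂ)
    (hg : ∀ i, (g i).totalDegree ≤ 1) (f : MvPolynomial σ ℂ) :
    (aeval g f).totalDegree ≤ f.totalDegree := by
  conv_lhs => rw [f.as_sum]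
  rw [map_sum]
  refine totalDegree_finsetSum_le fun m hm => ?_
  rw [aeval_monomial]
  refine (totalDegree_mul _ _).trans ?_
  have h1 : (algebraMap ℂ (MvPolynomial τ ℂ) (coeff m f)).totalDegree = 0 := totalDegree_C _
  rw [h1, zero_add, Finsupp.prod]
  refine (totalDegree_finsetProd _ _).trans (le_trans ?_ (le_totalDegree hm))
  refine Finset.sum_le_sum fun i _ => (totalDegree_pow _ _).trans ?_
  nlinarith [hg i]

theorem coeff_eq_zero_of_totalDegree_lt_sum [Fintype σ] {f : MvPolynomial σ ℂ} {m : σ →₀ ℕ}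
    (h : f.totalDegree < ∑ i, m i) : coeff m f = 0 := by
  apply coeff_eq_zero_of_totalDegree_lt
  rwa [Finset.sum_subset (Finset.subset_univ m.support) (by simp)]

/-- In top degree each factor X_i - c acts as X_i: the terms containing c have too small a degree to
reach the exponent in question. -/
theorem coeff_prod_X_sub_C_mul [Fintype σ] (c : ℂ) (s : Finset σ) (h : MvPolynomial σ ℂ)
    (m : σ →₀ ℕ) (hd : h.totalDegree ≤ ∑ i, m i) :
    coeff (m + ∑ i ∈ s, Finsupp.single i 1) ((∏ i ∈ s, (X i - C c)) * h) = coeff m h := by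
  classical
  induction s using Finset.induction_on with
  | empty => simp
  | insert a s ha ih =>
    rw [Finset.prod_insert ha, Finset.sum_insert ha, mul_assoc, sub_mul, coeff_sub,
      show m + (Finsupp.single a 1 + ∑ i ∈ s, Finsupp.single i 1)
        = Finsupp.single a 1 + (m + ∑ i ∈ s, Finsupp.single i 1) by abel, coeff_X_mul, ih,
      coeff_C_mul, sub_eq_self, mul_eq_zero]
    right
    apply coeff_eq_zero_of_totalDegree_lt_sum
    refine (totalDegree_mul _ _).trans_lt ?_
    rw [totalDegree_prod_of_eq_one s _ fun i _ => totalDegree_X_sub_C i c]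
    have : ∑ i, (Finsupp.single a 1 + (m + ∑ i ∈ s, Finsupp.single i 1) : σ →₀ ℕ) i
        = 1 + (∑ i, m i + s.card) := by
      simp [Finset.sum_add_distrib, Finsupp.single_apply]
    omega

end Degree

/-! ### The interpolation grid and its self-similarity -/

/-- The invariant `z + z⁻¹` of the inversion of `z`. -/
noncomputable def invSum (z : ℂ) : ℂ := z + z⁻¹

theorem invSum_inv (z : ℂ) : invSum z⁻¹ = invSum z := by simp [invSum, add_comm]

theorem invSum_sub {z w : ℂ} (hz : z ≠ 0) (hw : w ≠ 0) :
    invSum z - invSum w = z⁻¹ * (z - w) * (1 - z * w) * -w⁻¹ := by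
  unfold invSum; field_simp; ring

theorem invSum_ne {z w : ℂ} (hz : z ≠ 0) (hw : w ≠ 0) (h : z ≠ w) (h' : z * w ≠ 1) :
    invSum z ≠ invSum w := by
  rw [← sub_ne_zero, invSum_sub hz hw]
  simp [hz, hw, sub_ne_zero, h, h'.symm]

/-- The interpolation points `(q^{μ_i} t^{n-i} a)_i`. -/
noncomputable def grid {n : ℕ} (q t : ℝ) (a : ℂ) (mu : Fin n → ℕ) (i : Fin n) : ℂ :=
  (q : ℂ) ^ mu i * (t : ℂ) ^ delta n i * a

/-- The value of `f` at the interpolation point of `μ`, in the variables `x_i + x_i⁻¹`. -/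
noncomputable def gridEval {n : ℕ} (q t : ℝ) (a : ℂ) (mu : Fin n → ℕ) :
    MvPolynomial (Fin n) ℂ →+* ℂ :=
  eval fun i => invSum (grid q t a mu i)

/-- Genericity of the base point `a` of the interpolation grid. -/
def Generic (q t : ℝ) (a : ℂ) : Prop :=
  ∀ i j : ℕ, 1 ≤ i → (q : ℂ) ^ i * (t : ℂ) ^ j * a ^ 2 ≠ 1

/-- Only a² enters the condition, so the shift of the base raises the exponent of t, or of q in
`Generic.mul_q`, by 2. Both moves of the induction therefore preserve genericity. -/
theorem Generic.mul_t {q t : ℝ} {a : ℂ} (h : Generic q t a) : Generic q t (t * a) := by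
  intro i j hi e
  exact h i (j + 2) hi (by rw [← e]; ring)

theorem Generic.mul_q {q t : ℝ} {a : ℂ} (h : Generic q t a) : Generic q t (q * a) := by
  intro i j hi e
  exact h (i + 2) j (by omega) (by rw [← e]; ring)

theorem delta_castSucc {n : ℕ} (i : Fin n) : delta (n + 1) i.castSucc = delta n i + 1 := by
  simp only [delta, Fin.val_castSucc]; omega

theorem delta_last (n : ℕ) : delta (n + 1) (Fin.last n) = 0 := by simp [delta]

theorem delta_lt_delta {n : ℕ} {i j : Fin n} (h : i < j) : delta n j < delta n i := by
  simp only [delta]; omega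

/-- A vector extended by a zero. -/
def snocZero {n : ℕ} (mu : Fin n → ℕ) : Fin (n + 1) → ℕ := Fin.snoc (α := fun _ => ℕ) mu 0

@[simp] theorem snocZero_castSucc {n : ℕ} (mu : Fin n → ℕ) (i : Fin n) :
    snocZero mu i.castSucc = mu i := by simp [snocZero]

@[simp] theorem snocZero_last {n : ℕ} (mu : Fin n → ℕ) : snocZero mu (Fin.last n) = 0 := by
  simp [snocZero]

theorem isPartition_snocZero {n : ℕ} {mu : Fin n → ℕ} :
    IsPartition (snocZero mu) ↔ IsPartition mu := by
  constructor
  · intro h i j hij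
    simpa using h (Fin.castSucc_le_castSucc_iff.mpr hij)
  · intro h i j
    induction i using Fin.lastCases with
    | last =>
      intro hij
      rw [Fin.last_le_iff.mp hij]
    | cast i =>
      induction j using Fin.lastCases with
      | last => simp
      | cast j => intro hij; simpa using h (Fin.castSucc_le_castSucc_iff.mp hij)

theorem weight_snocZero {n : ℕ} (mu : Fin n → ℕ) : weight (snocZero mu) = weight mu := by
  simp [weight, Fin.sum_univ_castSucc]

theorem weight_add_one {n : ℕ} (mu : Fin n → ℕ) : weight (fun i => mu i + 1) = weight mu + n := by
  simp [weight, Finset.sum_add_distrib]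

theorem snocZero_injective {n : ℕ} : Function.Injective (snocZero (n := n)) := by
  intro mu nu h
  funext i
  simpa using congrFun h i.castSucc

/-- A partition of length at most `n + 1` either has length at most `n` or is obtained by adding
a full column. -/
theorem IsPartition.snocZero_or_add_one {n : ℕ} {mu : Fin (n + 1) → ℕ} (h : IsPartition mu) :
    (∃ nu, IsPartition nu ∧ mu = snocZero nu) ∨
      ∃ nu, IsPartition nu ∧ mu = fun i => nu i + 1 := by
  by_cases h0 : mu (Fin.last n) = 0
  · left
    have e : mu = snocZero fun i => mu i.castSucc := by
      funext i
      induction i using Fin.lastCases with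
      | last => simp [h0]
      | cast i => simp
    exact ⟨_, isPartition_snocZero.mp (e ▸ h), e⟩
  · right
    have hp : ∀ i, 1 ≤ mu i := fun i => by
      have := h (Fin.le_last i)
      omega
    refine ⟨fun i => mu i - 1, fun i j hij => Nat.sub_le_sub_right (h hij) 1, ?_⟩
    funext i
    exact (Nat.sub_add_cancel (hp i)).symm

theorem IsPartition.add_one {n : ℕ} {mu : Fin n → ℕ} (h : IsPartition mu) :
    IsPartition fun i => mu i + 1 :=
  fun _ _ hij => Nat.add_le_add_right (h hij) 1

/-- Induction on partitions by adding a zero part and by adding a full column. -/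
theorem partition_induction {motive : ∀ (n : ℕ) (mu : Fin n → ℕ), IsPartition mu → Prop}
    (nil : ∀ (mu : Fin 0 → ℕ) (h : IsPartition mu), motive 0 mu h)
    (snoc : ∀ (n : ℕ) (mu : Fin n → ℕ) (h : IsPartition mu), motive n mu h →
      motive (n + 1) (snocZero mu) (isPartition_snocZero.mpr h))
    (column : ∀ (n : ℕ) (mu : Fin (n + 1) → ℕ) (h : IsPartition mu), motive (n + 1) mu h →
      motive (n + 1) (fun i => mu i + 1) h.add_one) (n : ℕ) (mu : Fin n → ℕ)
    (h : IsPartition mu) : motive n mu h := by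
  induction n with
  | zero => exact nil mu h
  | succ n ih =>
    induction hw : weight mu using Nat.strong_induction_on generalizing mu with
    | _ w ihw =>
      rcases h.snocZero_or_add_one with ⟨nu, hnu, rfl⟩ | ⟨nu, hnu, rfl⟩
      · exact snoc n nu hnu (ih nu hnu)
      · rw [weight_add_one] at hw
        exact column n nu hnu (ihw (weight nu) (by omega) nu hnu rfl)

/-- Appending a part raises every earlier entry of δ by one, which the new base ta absorbs; the new
coordinate is a itself. -/
theorem grid_snocZero {n : ℕ} (q t : ℝ) (a : ℂ) (mu : Fin n → ℕ) :
    grid q t a (snocZero mu) = Fin.snoc (α := fun _ => ℂ) (grid q t (t * a) mu) a := by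
  funext i
  induction i using Fin.lastCases with
  | last => simp [grid, delta_last]
  | cast i => simp [grid, delta_castSucc]; ring

theorem grid_add_one {n : ℕ} (q t : ℝ) (a : ℂ) (mu : Fin n → ℕ) :
    grid q t a (fun i => mu i + 1) = grid q t (q * a) mu := by
  funext i
  simp [grid]; ring

/-! ### Specializing a variable and splitting off linear factors -/

/-- Specialization of the last variable. -/
noncomputable def restrict {n : ℕ} (c : ℂ) :
    MvPolynomial (Fin (n + 1)) ℂ →ₐ[ℂ] MvPolynomial (Fin n) ℂ :=
  aeval (Fin.snoc (α := fun _ => MvPolynomial (Fin n) ℂ) X (C c))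

theorem restrict_X_castSucc {n : ℕ} (c : ℂ) (i : Fin n) : restrict c (X i.castSucc) = X i := by
  simp [restrict]

theorem restrict_X_last {n : ℕ} (c : ℂ) : restrict c (X (Fin.last n)) = C c := by
  simp [restrict]

theorem eval_restrict {n : ℕ} (c : ℂ) (y : Fin n → ℂ) (f : MvPolynomial (Fin (n + 1)) ℂ) :
    eval y (restrict c f) = eval (Fin.snoc (α := fun _ => ℂ) y c) f := by
  have : (aeval y).comp (restrict c) = aeval (R := ℂ) (Fin.snoc (α := fun _ => ℂ) y c) := by
    apply MvPolynomial.algHom_ext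
    intro i
    induction i using Fin.lastCases with
    | last => simp [restrict_X_last]
    | cast i => simp [restrict_X_castSucc]
  simpa [aeval_eq_eval] using DFunLike.congr_fun this f

theorem gridEval_restrict {n : ℕ} (q t : ℝ) (a : ℂ) (mu : Fin n → ℕ)
    (f : MvPolynomial (Fin (n + 1)) ℂ) :
    gridEval q t (t * a) mu (restrict (invSum a) f) = gridEval q t a (snocZero mu) f := by
  rw [gridEval, eval_restrict, gridEval, grid_snocZero]
  congr 2
  funext i
  induction i using Fin.lastCases with
  | last => simp
  | cast i => simp

theorem totalDegree_restrict_le {n : ℕ} (c : ℂ) (f : MvPolynomial (Fin (n + 1)) ℂ) :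
    (restrict c f).totalDegree ≤ f.totalDegree := by
  apply totalDegree_aeval_le
  intro i
  induction i using Fin.lastCases with
  | last => simp
  | cast i => simp

theorem isSymmetric_restrict {n : ℕ} (c : ℂ) {f : MvPolynomial (Fin (n + 1)) ℂ}
    (hf : f.IsSymmetric) : (restrict c f).IsSymmetric := by
  intro e
  let e' : Equiv.Perm (Fin (n + 1)) :=
    finSuccEquivLast.trans ((Equiv.optionCongr e).trans finSuccEquivLast.symm)
  have : (rename e : _ →ₐ[ℂ] _).comp (restrict c) = (restrict c).comp (rename e') := by
    apply MvPolynomial.algHom_ext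
    intro i
    induction i using Fin.lastCases with
    | last => simp [restrict_X_last, e']
    | cast i => simp [restrict_X_castSucc, e']
  have := DFunLike.congr_fun this f
  simp only [AlgHom.comp_apply] at this
  rw [this, hf e']

theorem X_last_sub_C_dvd {n : ℕ} {c : ℂ} {f : MvPolynomial (Fin (n + 1)) ℂ}
    (h : restrict c f = 0) : X (Fin.last n) - C c ∣ f := by
  rw [X_sub_dvd_iff (subst_C _ _ _)]
  have : subst (Fin.last n) (C c) = (rename Fin.castSucc : _ →ₐ[ℂ] _).comp (restrict c) := by
    apply MvPolynomial.algHom_ext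
    intro i
    induction i using Fin.lastCases with
    | last => simp [restrict_X_last, subst_X_self]
    | cast i => simp [restrict_X_castSucc, subst_X_of_ne]
  rw [this, AlgHom.comp_apply, h, map_zero]

theorem rename_prod_X_sub_C {n : ℕ} (c : ℂ) (e : Equiv.Perm (Fin n)) :
    rename e (∏ i, (X i - C c) : MvPolynomial (Fin n) ℂ) = ∏ i, (X i - C c) := by
  simp only [map_prod, map_sub, rename_X, rename_C]
  exact Equiv.prod_comp e fun i => (X i - C c : MvPolynomial (Fin n) ℂ)

theorem prod_X_sub_C_ne_zero {n : ℕ} (c : ℂ) :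
    (∏ i, (X i - C c) : MvPolynomial (Fin n) ℂ) ≠ 0 :=
  Finset.prod_ne_zero_iff.mpr fun i _ => X_sub_C_ne_zero i c

/-- A symmetric polynomial which vanishes when one variable equals `c` is divisible by
`∏ (X_i - c)`, with symmetric quotient. -/
theorem exists_eq_prod_mul_of_restrict_eq_zero {n : ℕ} {c : ℂ} {f : MvPolynomial (Fin (n + 1)) ℂ}
    (hf : f.IsSymmetric) (h0 : f ≠ 0) (h : restrict c f = 0) :
    ∃ g : MvPolynomial (Fin (n + 1)) ℂ, g.IsSymmetric ∧ f = (∏ i, (X i - C c)) * g ∧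
      f.totalDegree = n + 1 + g.totalDegree := by
  have hdvd : ∀ i, X i - C c ∣ f := fun i => by
    have := map_dvd (rename (R := ℂ) (Equiv.swap (Fin.last n) i)) (X_last_sub_C_dvd h)
    rw [hf] at this
    simpa using this
  obtain ⟨g, rfl⟩ := prod_X_sub_C_dvd c f hdvd
  have hg : g ≠ 0 := right_ne_zero_of_mul h0
  refine ⟨g, fun e => ?_, rfl, ?_⟩
  · have := hf e
    rw [map_mul, rename_prod_X_sub_C] at this
    exact mul_left_cancel₀ (prod_X_sub_C_ne_zero c) this
  · rw [totalDegree_mul_of_isDomain (prod_X_sub_C_ne_zero c) hg,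
      totalDegree_prod_of_eq_one _ _ fun i _ => totalDegree_X_sub_C i c]
    simp

theorem gridEval_prod_X_sub_C {n : ℕ} (q t : ℝ) (a c : ℂ) (mu : Fin n → ℕ) :
    gridEval q t a mu (∏ i, (X i - C c)) = ∏ i, (invSum (grid q t a mu i) - c) := by
  simp [gridEval, map_prod]

theorem gridEval_add_one {n : ℕ} (q t : ℝ) (a : ℂ) (mu : Fin n → ℕ) :
    gridEval q t a (fun i => mu i + 1) = gridEval q t (q * a) mu := by
  rw [gridEval, gridEval, grid_add_one]

theorem grid_ne_zero {n : ℕ} {q t : ℝ} (hq : 0 < q) (ht : 0 < t) {a : ℂ} (ha : a ≠ 0)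
    (mu : Fin n → ℕ) (i : Fin n) : grid q t a mu i ≠ 0 := by
  have hq' : (q : ℂ) ≠ 0 := by exact_mod_cast hq.ne'
  have ht' : (t : ℂ) ≠ 0 := by exact_mod_cast ht.ne'
  simp [grid, ha, hq', ht']

/-- Makes the factors ∏ (y_i - a - 1/a) cancellable at points with a full column. The full column
supplies a positive power of q, so coincidence with a is excluded by size and coincidence with 1/a
by `Generic`. -/
theorem invSum_grid_add_one_ne {n : ℕ} {q t : ℝ} (hq : 0 < q) (hq1 : q < 1) (ht : 0 < t)
    (ht1 : t < 1) {a : ℂ} (ha : a ≠ 0) (hgen : Generic q t a) (mu : Fin n → ℕ) (i : Fin n) :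
    invSum (grid q t a (fun i => mu i + 1) i) ≠ invSum a := by
  apply invSum_ne (grid_ne_zero hq ht ha _ i) ha
  · intro e
    have h1 : (q : ℂ) ^ (mu i + 1) * (t : ℂ) ^ delta n i = 1 := mul_right_cancel₀ ha (by
      simpa [grid] using e)
    have h2 : q ^ (mu i + 1) * t ^ delta n i = 1 := by exact_mod_cast h1
    have h3 : q ^ (mu i + 1) < 1 := pow_lt_one₀ hq.le hq1 (by omega)
    have h4 : t ^ delta n i ≤ 1 := pow_le_one₀ ht.le ht1.le
    have h5 : 0 < t ^ delta n i := by positivity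
    nlinarith
  · have := hgen (mu i + 1) (delta n i) (by omega)
    rwa [pow_two, ← mul_assoc] at this

/-! ### Uniqueness of interpolation -/

/-- A symmetric polynomial of degree at most `d` is determined by its values at the points of
the partitions of weight at most `d`. -/
theorem eq_zero_of_gridEval_eq_zero {n : ℕ} {q t : ℝ} (hq : 0 < q) (hq1 : q < 1) (ht : 0 < t)
    (ht1 : t < 1) {a : ℂ} (ha : a ≠ 0) (hgen : Generic q t a) {d : ℕ}
    {f : MvPolynomial (Fin n) ℂ} (hf : f.IsSymmetric) (hd : f.totalDegree ≤ d)
    (hv : ∀ mu : Fin n → ℕ, IsPartition mu → weight mu ≤ d → gridEval q t a mu f = 0) :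
    f = 0 := by
  have hqc : (q : ℂ) ≠ 0 := by exact_mod_cast hq.ne'
  have htc : (t : ℂ) ≠ 0 := by exact_mod_cast ht.ne'
  induction n generalizing a d with
  | zero =>
    apply MvPolynomial.funext
    intro x
    have := hv (fun i => i.elim0) (fun i => i.elim0) (by simp [weight])
    rwa [gridEval, Subsingleton.elim (fun i : Fin 0 => _) x] at this
  | succ n ihn =>
    induction d using Nat.strong_induction_on generalizing a f with
    | _ d ihd =>
      by_contra h0
      -- The points with last part 0 form the grid in n variables with base ta.
      have hr : restrict (invSum a) f = 0 :=
        ihn (mul_ne_zero htc ha) hgen.mul_t (isSymmetric_restrict _ hf)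
          ((totalDegree_restrict_le _ f).trans hd) fun mu hmu hw => by
            rw [gridEval_restrict]
            exact hv _ (isPartition_snocZero.mpr hmu) (by rwa [weight_snocZero])
      obtain ⟨g, hg, e, hdeg⟩ := exists_eq_prod_mul_of_restrict_eq_zero hf h0 hr
      apply h0
      -- As f is nonzero, its degree is n + 1 + deg g, which forces d ≥ n + 1, so d - (n + 1) is a
      -- genuine decrease.
      rw [e, ihd (d - (n + 1)) (by omega) (mul_ne_zero hqc ha) hgen.mul_q hg (by omega), mul_zero]
      intro mu hmu hw
      have := hv (fun i => mu i + 1) hmu.add_one (by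
        rw [weight_add_one]; omega)
      rw [e, map_mul, gridEval_prod_X_sub_C, mul_eq_zero] at this
      rw [← gridEval_add_one]
      refine this.resolve_left (Finset.prod_ne_zero_iff.mpr fun i _ => sub_ne_zero.mpr ?_)
      exact invSum_grid_add_one_ne hq hq1 ht ht1 ha hgen mu i

/-! ### The value at the point of λ as a product over boxes -/

/-- An exponent vector as a finitely supported function. -/
noncomputable def expo {n : ℕ} (m : Fin n → ℕ) : Fin n →₀ ℕ := Finsupp.equivFunOnFinite.symm m

@[simp] theorem expo_apply {n : ℕ} (m : Fin n → ℕ) (i : Fin n) : expo m i = m i := rfl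

theorem expo_injective {n : ℕ} : Function.Injective (expo (n := n)) :=
  Finsupp.equivFunOnFinite.symm.injective

theorem expo_coe {n : ℕ} (m : Fin n →₀ ℕ) : expo (⇑m) = m := by ext; simp

theorem sum_le_totalDegree {n : ℕ} {f : MvPolynomial (Fin n) ℂ} {m : Fin n →₀ ℕ}
    (hm : m ∈ f.support) : ∑ i, m i ≤ f.totalDegree := by
  by_contra! h
  exact mem_support_iff.mp hm (coeff_eq_zero_of_totalDegree_lt_sum h)

theorem totalDegree_le_of_forall {n : ℕ} {f : MvPolynomial (Fin n) ℂ} {d : ℕ}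
    (h : ∀ m ∈ f.support, ∑ i, m i ≤ d) : f.totalDegree ≤ d := by
  refine Finset.sup_le fun m hm => ?_
  rw [Finsupp.sum_fintype _ _ fun _ => rfl]
  exact h m hm

/-- A monomial of f with a positive exponent in the last variable restricts to degree less than |m|,
so it does not contribute to y^m. -/
theorem coeff_restrict {n : ℕ} (c : ℂ) (f : MvPolynomial (Fin (n + 1)) ℂ) (m : Fin n → ℕ)
    (hd : f.totalDegree ≤ weight m) :
    coeff (expo m) (restrict c f) = coeff (expo (snocZero m)) f := by
  have key : ∀ k ∈ f.support, coeff (expo m) (restrict c (monomial k (coeff k f))) =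
      if k = expo (snocZero m) then coeff k f else 0 := by
    intro k hk
    have hle := (sum_le_totalDegree hk).trans hd
    rw [Fin.sum_univ_castSucc] at hle
    have e : restrict c (monomial k (coeff k f)) =
        monomial (expo fun i : Fin n => k i.castSucc) (coeff k f * c ^ k (Fin.last n)) := by
      rw [restrict, aeval_monomial, Finsupp.prod_fintype _ _ (by simp), Fin.prod_univ_castSucc,
        monomial_eq, Finsupp.prod_fintype _ _ (by simp)]
      simp only [Fin.snoc_castSucc, Fin.snoc_last, expo_apply, C_mul, C_pow, algebraMap_eq]
      ring
    rw [e, coeff_monomial]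
    by_cases h : k = expo (snocZero m)
    · have h' : (expo fun i : Fin n => k i.castSucc) = expo m := by
        ext i; simp [h]
      rw [if_pos h', if_pos h]
      simp [h]
    · rw [if_neg h, if_neg]
      intro h'
      apply h
      have hi : ∀ i : Fin n, k i.castSucc = m i := fun i => by
        simpa using DFunLike.congr_fun h' i
      simp only [hi, weight] at hle
      ext i
      induction i using Fin.lastCases with
      | last => simp; omega
      | cast i => simp [hi]
  conv_lhs => rw [f.as_sum]
  rw [map_sum, coeff_sum, Finset.sum_congr rfl key, Finset.sum_ite_eq']
  split_ifs with h
  · rfl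
  · exact (notMem_support_iff.mp h).symm

theorem prod_Icc_one_succ (F : ℕ → ℂ) (m : ℕ) :
    ∏ j ∈ Finset.Icc 1 (m + 1), F j = F 1 * ∏ j ∈ Finset.Icc 1 m, F (j + 1) := by
  induction m with
  | zero => simp
  | succ m ih =>
    rw [Finset.prod_Icc_succ_top (by omega), ih, Finset.prod_Icc_succ_top (by omega), mul_assoc]

theorem conjPart_le {n : ℕ} (lam : Fin n → ℕ) (j : ℕ) : conjPart lam j ≤ n :=
  (Finset.card_filter_le _ _).trans (by simp)

theorem conjPart_snocZero {n : ℕ} (mu : Fin n → ℕ) {j : ℕ} (hj : 1 ≤ j) :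
    conjPart (snocZero mu) j = conjPart mu j := by
  simp only [conjPart, Finset.card_filter, Fin.sum_univ_castSucc, snocZero_castSucc, snocZero_last]
  rw [if_neg (by omega), add_zero]

theorem conjPart_add_one {n : ℕ} (mu : Fin n → ℕ) (j : ℕ) :
    conjPart (fun i => mu i + 1) (j + 1) = conjPart mu j := by
  simp [conjPart]

theorem conjPart_add_one_one {n : ℕ} (mu : Fin n → ℕ) :
    conjPart (fun i => mu i + 1) 1 = n := by
  simp [conjPart]

/-- The product over the boxes of the diagram of `λ` which is the value of the interpolation
Macdonald polynomial at its own interpolation point. -/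
noncomputable def boxProd {n : ℕ} (q t : ℝ) (a : ℂ) (lam : Fin n → ℕ) : ℂ :=
  ∏ i, ∏ j ∈ Finset.Icc 1 (lam i),
    (invSum (grid q t a lam i) - invSum ((q : ℂ) ^ (j - 1) * (t : ℂ) ^ (n - conjPart lam j) * a))

theorem boxProd_snocZero {n : ℕ} (q t : ℝ) (a : ℂ) (mu : Fin n → ℕ) :
    boxProd q t a (snocZero mu) = boxProd q t (t * a) mu := by
  simp only [boxProd, Fin.prod_univ_castSucc, snocZero_castSucc, snocZero_last, grid_snocZero,
    Fin.snoc_castSucc]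
  rw [Finset.Icc_eq_empty (by omega), Finset.prod_empty, mul_one]
  refine Finset.prod_congr rfl fun i _ => Finset.prod_congr rfl fun j hj => ?_
  rw [conjPart_snocZero mu (Finset.mem_Icc.mp hj).1, Nat.succ_sub (conjPart_le mu j), pow_succ]
  ring_nf

theorem boxProd_add_one {n : ℕ} (q t : ℝ) (a : ℂ) (mu : Fin n → ℕ) :
    boxProd q t a (fun i => mu i + 1) =
      (∏ i, (invSum (grid q t a (fun i => mu i + 1) i) - invSum a)) * boxProd q t (q * a) mu := by
  simp only [boxProd, prod_Icc_one_succ, Finset.prod_mul_distrib]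
  congr 1
  · simp [conjPart_add_one_one]
  · refine Finset.prod_congr rfl fun i _ => Finset.prod_congr rfl fun j hj => ?_
    rw [conjPart_add_one, grid_add_one]
    obtain ⟨k, rfl⟩ := Nat.exists_eq_add_of_le (Finset.mem_Icc.mp hj).1
    simp only [Nat.add_sub_cancel_left, Nat.add_sub_cancel, pow_add, pow_one]
    ring_nf

theorem expo_add_one {n : ℕ} (mu : Fin n → ℕ) :
    expo (fun i => mu i + 1) = expo mu + ∑ i, Finsupp.single i 1 := by
  ext i
  simp [Finsupp.single_apply]

/-- Follows the two moves on λ: a zero part is removed by specialization, a full column by dividing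
f by ∏ (y_i - a - 1/a). The value of that product at the point of λ is the contribution of the first
column to `boxProd`, and the division does not change the top coefficient. The vanishing hypothesis
covers only |μ| ≤ |λ|. -/
theorem gridEval_eq_coeff_mul_boxProd {n : ℕ} {q t : ℝ} (hq : 0 < q) (hq1 : q < 1) (ht : 0 < t)
    (ht1 : t < 1) {lam : Fin n → ℕ} (hlam : IsPartition lam) {a : ℂ} (ha : a ≠ 0)
    (hgen : Generic q t a) {f : MvPolynomial (Fin n) ℂ} (hf : f.IsSymmetric)
    (hd : f.totalDegree ≤ weight lam)
    (hv : ∀ mu : Fin n → ℕ, IsPartition mu → weight mu ≤ weight lam → mu ≠ lam →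
      gridEval q t a mu f = 0) :
    gridEval q t a lam f = coeff (expo lam) f * boxProd q t a lam := by
  have hqc : (q : ℂ) ≠ 0 := by exact_mod_cast hq.ne'
  have htc : (t : ℂ) ≠ 0 := by exact_mod_cast ht.ne'
  induction n, lam, hlam using partition_induction generalizing a with
  | nil mu hmu =>
    rw [boxProd, Finset.univ_eq_empty, Finset.prod_empty, mul_one, eq_C_of_isEmpty f,
      gridEval, eval_C, Subsingleton.elim (expo mu) 0, coeff_C, if_pos rfl]
  | snoc n lam hlam ih =>
    rw [weight_snocZero] at hd
    rw [← gridEval_restrict, ih (mul_ne_zero htc ha) hgen.mul_t (isSymmetric_restrict _ hf)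
      ((totalDegree_restrict_le _ f).trans hd), boxProd_snocZero, coeff_restrict _ _ _ hd]
    intro mu hmu hw hne
    rw [gridEval_restrict]
    exact hv _ (isPartition_snocZero.mpr hmu) (by rwa [weight_snocZero, weight_snocZero])
      fun e => hne (snocZero_injective e)
  | column n lam hlam ih =>
    by_cases h0 : f = 0
    · simp [h0]
    -- A partition with last part 0 is never the one with the added column, so f vanishes at all
    -- such points within the weight bound.
    have hr : restrict (invSum a) f = 0 :=
      eq_zero_of_gridEval_eq_zero hq hq1 ht ht1 (mul_ne_zero htc ha) hgen.mul_t
        (isSymmetric_restrict _ hf) ((totalDegree_restrict_le _ f).trans hd) fun mu hmu hw => by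
          rw [gridEval_restrict]
          refine hv _ (isPartition_snocZero.mpr hmu) (by rwa [weight_snocZero]) fun e => ?_
          simpa using congrFun e (Fin.last n)
    obtain ⟨g, hg, rfl, hdeg⟩ := exists_eq_prod_mul_of_restrict_eq_zero hf h0 hr
    rw [weight_add_one] at hd
    have hdg : g.totalDegree ≤ weight lam := by omega
    rw [map_mul, gridEval_prod_X_sub_C, gridEval_add_one,
      ih (mul_ne_zero hqc ha) hgen.mul_q hg hdg, boxProd_add_one, expo_add_one,
      coeff_prod_X_sub_C_mul _ _ _ _ hdg]
    · ring
    intro mu hmu hw hne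
    have := hv (fun i => mu i + 1) hmu.add_one
      (by simpa [weight_add_one] using hw) fun e => hne (funext fun i => by
        simpa using congrFun e i)
    rw [map_mul, gridEval_prod_X_sub_C, mul_eq_zero] at this
    rw [← gridEval_add_one]
    refine this.resolve_left (Finset.prod_ne_zero_iff.mpr fun i _ => sub_ne_zero.mpr ?_)
    exact invSum_grid_add_one_ne hq hq1 ht ht1 ha hgen mu i

/-! ### Existence by counting dimensions -/

/-- The sum of the rearrangements of a monomial, with multiplicities. -/
noncomputable def orbitSum {n : ℕ} (m : Fin n → ℕ) : MvPolynomial (Fin n) ℂ :=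
  ∑ e : Equiv.Perm (Fin n), monomial (expo (m ∘ e)) 1

theorem isSymmetric_orbitSum {n : ℕ} (m : Fin n → ℕ) : (orbitSum m).IsSymmetric := by
  intro e
  simp only [orbitSum, map_sum, rename_monomial]
  rw [← Equiv.sum_comp (Equiv.mulRight e)]
  refine Finset.sum_congr rfl fun s _ => ?_
  have : Finsupp.mapDomain e (expo (m ∘ Equiv.mulRight e s)) = expo (m ∘ s) := by
    rw [← Finsupp.equivMapDomain_eq_mapDomain]
    ext i
    simp [Finsupp.equivMapDomain_apply]
  rw [this]

theorem totalDegree_orbitSum_le {n : ℕ} (m : Fin n → ℕ) :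
    (orbitSum m).totalDegree ≤ weight m := by
  refine totalDegree_finsetSum_le fun e _ => totalDegree_le_of_forall fun k hk => ?_
  have := Finset.mem_singleton.mp (support_monomial_subset hk)
  subst this
  simp only [expo_apply, Function.comp_apply, weight]
  exact (Equiv.sum_comp e m).le

theorem coeff_orbitSum_self {n : ℕ} (m : Fin n → ℕ) : coeff (expo m) (orbitSum m) ≠ 0 := by
  simp only [orbitSum, coeff_sum, coeff_monomial]
  rw [Finset.sum_boole, Nat.cast_ne_zero, ← Nat.pos_iff_ne_zero, Finset.card_pos]
  exact ⟨1, by simp⟩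

/-- Each orbit of exponent vectors contains only one weakly decreasing vector. -/
theorem coeff_orbitSum_of_ne {n : ℕ} {m k : Fin n → ℕ} (hm : IsPartition m) (hk : IsPartition k)
    (h : m ≠ k) : coeff (expo k) (orbitSum m) = 0 := by
  simp only [orbitSum, coeff_sum, coeff_monomial]
  refine Finset.sum_eq_zero fun e _ => if_neg fun he => h ?_
  have he' := expo_injective he
  have := Tuple.unique_antitone (f := m) (σ := 1) (τ := e) hm (by rw [he']; exact hk)
  rw [he'] at this
  simpa using this

theorem finite_setOf_weight_le (n d : ℕ) :
    {mu : Fin n → ℕ | IsPartition mu ∧ weight mu ≤ d}.Finite := by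
  refine (Set.Finite.pi' (t := fun _ : Fin n => Set.Iic d) fun _ => Set.finite_Iic d).subset ?_
  rintro mu ⟨-, h⟩ i
  exact (Finset.single_le_sum (f := mu) (fun _ _ => Nat.zero_le _) (Finset.mem_univ i)).trans h

/-- There is a nonzero symmetric polynomial of degree at most `|λ|` that vanishes at the points of
all other partitions of weight at most `|λ|`. -/
theorem exists_gridEval_eq_zero {n : ℕ} (q t : ℝ) (a : ℂ) {lam : Fin n → ℕ}
    (hlam : IsPartition lam) :
    ∃ f : MvPolynomial (Fin n) ℂ, f ≠ 0 ∧ f.IsSymmetric ∧ f.totalDegree ≤ weight lam ∧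
      ∀ mu : Fin n → ℕ, IsPartition mu → weight mu ≤ weight lam → mu ≠ lam →
        gridEval q t a mu f = 0 := by
  classical
  set S : Finset (Fin n → ℕ) := (finite_setOf_weight_le n (weight lam)).toFinset with hS
  have hmem : ∀ mu, mu ∈ S ↔ IsPartition mu ∧ weight mu ≤ weight lam := by simp [hS]
  let F : (S → ℂ) →ₗ[ℂ] MvPolynomial (Fin n) ℂ := Fintype.linearCombination ℂ fun nu => orbitSum nu.1
  let E : (S → ℂ) →ₗ[ℂ] (S.erase lam → ℂ) := LinearMap.pi fun mu =>
    (aeval (R := ℂ) fun i => invSum (grid q t a mu.1 i)).toLinearMap.comp F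
  -- There is one unknown for each partition in S and one equation for each except λ, so a nonzero
  -- solution exists.
  have hlt : Module.finrank ℂ (S.erase lam → ℂ) < Module.finrank ℂ (S → ℂ) := by
    rw [Module.finrank_fintype_fun_eq_card, Module.finrank_fintype_fun_eq_card,
      Fintype.card_coe, Fintype.card_coe]
    exact Finset.card_erase_lt_of_mem ((hmem lam).mpr ⟨hlam, le_rfl⟩)
  obtain ⟨v, hv, hv0⟩ := (Submodule.ne_bot_iff _).mp (LinearMap.ker_ne_bot_of_finrank_lt hlt)
  have hF : F v = ∑ nu, v nu • orbitSum nu.1 := Fintype.linearCombination_apply ..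
  refine ⟨F v, ?_, ?_, ?_, ?_⟩
  · intro h0
    apply hv0
    funext nu
    have h1 := congrArg (coeff (expo nu.1)) h0
    rw [hF, coeff_sum, Finset.sum_eq_single nu] at h1
    · simpa [coeff_orbitSum_self] using h1
    · intro ka _ hne
      rw [coeff_smul, coeff_orbitSum_of_ne ((hmem _).mp ka.2).1 ((hmem _).mp nu.2).1
        fun e => hne (Subtype.ext e), smul_zero]
    · simp
  · intro e
    simp only [hF, map_sum, map_smul]
    exact Finset.sum_congr rfl fun nu _ => by rw [isSymmetric_orbitSum nu.1 e]
  · rw [hF]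
    exact totalDegree_finsetSum_le fun nu _ => (totalDegree_smul_le _ _).trans
      ((totalDegree_orbitSum_le _).trans ((hmem _).mp nu.2).2)
  · intro mu hmu hw hne
    have hm : mu ∈ S.erase lam := Finset.mem_erase.mpr ⟨hne, (hmem mu).mpr ⟨hmu, hw⟩⟩
    have h1 : E v ⟨mu, hm⟩ = 0 := by rw [LinearMap.mem_ker.mp hv]; rfl
    have h2 : E v ⟨mu, hm⟩ = aeval (R := ℂ) (fun i => invSum (grid q t a mu i)) (F v) := rfl
    rw [aeval_eq_eval] at h2
    exact h2.symm.trans h1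

/-! ### The q-difference operator -/

/-- The coefficient function of the `q`-difference operator in one variable. -/
noncomputable def shiftCoeff (a u x : ℂ) : ℂ := (1 - a * x) * (1 - u * x) / (1 - x ^ 2)

/-- `x` or `x⁻¹`. -/
noncomputable def signPow (b : Bool) (x : ℂ) : ℂ := if b then x else x⁻¹

/-- Laurent polynomials in x are free over the polynomials in y = x + 1/x, with basis 1, x. The
bounds are stated on coefficients so that deg p₁ < k + m also makes sense for k + m = 0, where p₁ =
0. -/
theorem exists_decomposition_invSum_pow {r s : ℂ} (hr : r ≠ 0) (hs : s ≠ 0) (k m : ℕ) :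
    ∃ p₀ p₁ : Polynomial ℂ, (∀ j, k + m < j → p₀.coeff j = 0) ∧ (∀ j, k + m ≤ j → p₁.coeff j = 0) ∧
      ∀ x, x ≠ 0 → invSum (r * x) ^ k * invSum (s * x) ^ m =
        p₀.eval (invSum x) + x * p₁.eval (invSum x) := by
  have step : ∀ c : ℂ, c ≠ 0 → ∀ (N : ℕ) (p₀ p₁ : Polynomial ℂ), (∀ j, N < j → p₀.coeff j = 0) →
      (∀ j, N ≤ j → p₁.coeff j = 0) → ∃ p₀' p₁' : Polynomial ℂ,
        (∀ j, N + 1 < j → p₀'.coeff j = 0) ∧ (∀ j, N + 1 ≤ j → p₁'.coeff j = 0) ∧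
        ∀ x, x ≠ 0 → invSum (c * x) * (p₀.eval (invSum x) + x * p₁.eval (invSum x)) =
          p₀'.eval (invSum x) + x * p₁'.eval (invSum x) := by
    intro c hc N p₀ p₁ h₀ h₁
    -- From cx + 1/(cx) = c⁻¹ y + (c - c⁻¹) x and x² = xy - 1.
    refine ⟨Polynomial.C c⁻¹ * (Polynomial.X * p₀) - Polynomial.C (c - c⁻¹) * p₁,
      Polynomial.C c⁻¹ * (Polynomial.X * p₁) + Polynomial.C (c - c⁻¹) * p₀ +
        Polynomial.C (c - c⁻¹) * (Polynomial.X * p₁), ?_, ?_, ?_⟩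
    · rintro (_ | j) hj
      · omega
      · simp only [Polynomial.coeff_sub, Polynomial.coeff_C_mul, Polynomial.coeff_X_mul]
        rw [h₀ j (by omega), h₁ (j + 1) (by omega)]; simp
    · rintro (_ | j) hj
      · omega
      · simp only [Polynomial.coeff_add, Polynomial.coeff_C_mul, Polynomial.coeff_X_mul]
        rw [h₀ (j + 1) (by omega), h₁ j (by omega)]; simp
    · intro x hx
      simp only [Polynomial.eval_add, Polynomial.eval_sub, Polynomial.eval_mul, Polynomial.eval_C,
        Polynomial.eval_X, invSum]
      field_simp
      ring
  induction k with
  | zero =>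
    induction m with
    | zero => exact ⟨1, 0, fun j hj => by rw [Polynomial.coeff_one, if_neg (by omega)], by simp,
        by simp⟩
    | succ m ih =>
      obtain ⟨p₀, p₁, h₀, h₁, h⟩ := ih
      obtain ⟨p₀', p₁', h₀', h₁', h'⟩ := step s hs _ p₀ p₁ h₀ h₁
      refine ⟨p₀', p₁', h₀', h₁', fun x hx => ?_⟩
      rw [← h' x hx, ← h x hx]; ring
  | succ k ih =>
    obtain ⟨p₀, p₁, h₀, h₁, h⟩ := ih
    obtain ⟨p₀', p₁', h₀', h₁', h'⟩ := step r hr _ p₀ p₁ h₀ h₁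
    refine ⟨p₀', p₁', fun j hj => h₀' j (by omega), fun j hj => h₁' j (by omega), fun x hx => ?_⟩
    rw [← h' x hx, ← h x hx]; ring

/-- Symmetrizing under x ↦ 1/x with weight `shiftCoeff` cancels the pole at x² = 1: it sends 1 to 1
- au and x to a + u - au y. It is linear over polynomials in y, so the decomposition on the basis 1,
x gives the result. -/
theorem exists_polynomial_shift {r s : ℂ} (hr : r ≠ 0) (hs : s ≠ 0) (a u : ℂ) (k m : ℕ) :
    ∃ l : Polynomial ℂ, l.natDegree ≤ k + m ∧ ∀ x, x ≠ 0 → x ^ 2 ≠ 1 →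
      l.eval (invSum x) = ∑ b, shiftCoeff a u (signPow b x) *
        (invSum (r * signPow b x) ^ k * invSum (s * signPow b x) ^ m) := by
  obtain ⟨p₀, p₁, h₀, h₁, h⟩ := exists_decomposition_invSum_pow hr hs k m
  refine ⟨Polynomial.C (1 - a * u) * p₀ + Polynomial.C (a + u) * p₁ -
    Polynomial.C (a * u) * (Polynomial.X * p₁), ?_, fun x hx hx1 => ?_⟩
  · rw [Polynomial.natDegree_le_iff_coeff_eq_zero]
    rintro (_ | j) hj
    · omega
    · simp only [Polynomial.coeff_sub, Polynomial.coeff_add, Polynomial.coeff_C_mul,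
        Polynomial.coeff_X_mul]
      rw [h₀ (j + 1) hj, h₁ (j + 1) (by omega), h₁ j (by omega)]; simp
  · have hx1' : 1 - x ^ 2 ≠ 0 := sub_ne_zero.mpr hx1.symm
    have e : shiftCoeff a u x⁻¹ = -((x - a) * (x - u) / (1 - x ^ 2)) := by
      have : 1 - x⁻¹ ^ 2 ≠ 0 := by
        intro h
        apply hx1
        field_simp at h
        linear_combination h
      rw [shiftCoeff, ← neg_div, div_eq_div_iff this hx1']
      field_simp
      ring
    simp only [Fintype.sum_bool, signPow, if_true, Bool.false_eq_true, if_false]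
    rw [h x hx, h x⁻¹ (inv_ne_zero hx), invSum_inv, e, shiftCoeff]
    simp only [Polynomial.eval_add, Polynomial.eval_sub, Polynomial.eval_mul, Polynomial.eval_C,
      Polynomial.eval_X]
    generalize Polynomial.eval (invSum x) p₀ = A
    generalize Polynomial.eval (invSum x) p₁ = B
    rw [invSum]
    field_simp
    ring

theorem totalDegree_aeval_X_le {n : ℕ} (i : Fin n) (p : Polynomial ℂ) :
    (Polynomial.aeval (X i : MvPolynomial (Fin n) ℂ) p).totalDegree ≤ p.natDegree := by
  rw [Polynomial.aeval_eq_sum_range]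
  refine totalDegree_finsetSum_le fun j hj => (totalDegree_smul_le _ _).trans ?_
  rw [totalDegree_X_pow]
  exact Nat.lt_succ_iff.mp (Finset.mem_range.mp hj)

theorem det_vandermonde_eq_sum {R : Type*} [CommRing R] {n : ℕ} (v : Fin n → R) :
    (Matrix.vandermonde v).det =
      ∑ w : Equiv.Perm (Fin n), ((Equiv.Perm.sign w : ℤ) : R) * ∏ i, v i ^ (w i : ℕ) := by
  rw [← Matrix.det_transpose, Matrix.det_apply']
  rfl

theorem rename_vdm {n : ℕ} (e : Equiv.Perm (Fin n)) :
    rename e (vdm n) = ((Equiv.Perm.sign e : ℤ) : MvPolynomial (Fin n) ℂ) * vdm n := by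
  rw [vdm, AlgHom.map_det, ← Matrix.det_permute]
  congr 1
  ext i j : 2
  simp [Matrix.vandermonde_apply]

theorem totalDegree_vdm (n : ℕ) : (vdm n).totalDegree = ∑ i : Fin n, (i : ℕ) := by
  rw [vdm_eq_prod, totalDegree_prod_of_eq_one _ _ fun p hp =>
    totalDegree_X_sub_X (Finset.mem_filter.mp hp).2.ne', Finset.card_filter,
    ← Finset.univ_product_univ, Finset.sum_product_right]
  refine Finset.sum_congr rfl fun j _ => ?_
  rw [← Finset.card_filter]
  have : (Finset.univ.filter fun i : Fin n => i < j) = Finset.Iio j := by ext; simp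
  rw [this, Fin.card_Iio]

theorem eval_vdm {n : ℕ} (y : Fin n → ℂ) : eval y (vdm n) = (Matrix.vandermonde y).det := by
  rw [vdm, RingHom.map_det]
  congr 1
  ext i j
  simp [Matrix.vandermonde_apply]

/-- The numerator of the `q`-difference operator, for given one-variable polynomials. -/
noncomputable def shiftNumerator {n : ℕ} (l : ℕ → ℕ → Polynomial ℂ) (f : MvPolynomial (Fin n) ℂ) :
    MvPolynomial (Fin n) ℂ :=
  ∑ m ∈ f.support, ∑ w : Equiv.Perm (Fin n), ((Equiv.Perm.sign w : ℤ) : MvPolynomial (Fin n) ℂ) *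
    (C (coeff m f) * ∏ i, Polynomial.aeval (X i : MvPolynomial (Fin n) ℂ) (l (w i) (m i)))

theorem totalDegree_shiftNumerator_le {n : ℕ} {l : ℕ → ℕ → Polynomial ℂ}
    (hl : ∀ k m, (l k m).natDegree ≤ k + m) (f : MvPolynomial (Fin n) ℂ) :
    (shiftNumerator l f).totalDegree ≤ ∑ i : Fin n, (i : ℕ) + f.totalDegree := by
  refine totalDegree_finsetSum_le fun m hm => totalDegree_finsetSum_le fun w _ => ?_
  have hC : (((Equiv.Perm.sign w : ℤ) : MvPolynomial (Fin n) ℂ)).totalDegree = 0 := by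
    rw [← map_intCast (C : ℂ →+* MvPolynomial (Fin n) ℂ), totalDegree_C]
  refine (totalDegree_mul _ _).trans ?_
  rw [hC, zero_add]
  refine (totalDegree_mul _ _).trans ?_
  rw [totalDegree_C, zero_add]
  refine (totalDegree_finsetProd _ _).trans ?_
  refine (Finset.sum_le_sum fun i _ => (totalDegree_aeval_X_le i _).trans (hl _ _)).trans ?_
  rw [Finset.sum_add_distrib, Equiv.sum_comp w fun i : Fin n => (i : ℕ)]
  exact Nat.add_le_add_left (sum_le_totalDegree hm) _

/-- Permuting the variables is undone by reindexing the exponents m of the symmetric f and replacing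
w by we, at the cost of the sign of e. -/
theorem rename_shiftNumerator {n : ℕ} (l : ℕ → ℕ → Polynomial ℂ) {f : MvPolynomial (Fin n) ℂ}
    (hf : f.IsSymmetric) (e : Equiv.Perm (Fin n)) :
    rename e (shiftNumerator l f) =
      ((Equiv.Perm.sign e : ℤ) : MvPolynomial (Fin n) ℂ) * shiftNumerator l f := by
  have hc : ∀ (e : Equiv.Perm (Fin n)) (m : Fin n →₀ ℕ),
      coeff (Finsupp.mapDomain e m) f = coeff m f := fun e m => by
    conv_lhs => rw [← hf e]
    exact coeff_rename_mapDomain _ e.injective _ _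
  have hren : ∀ (i : Fin n) (p : Polynomial ℂ),
      rename e (Polynomial.aeval (X i : MvPolynomial (Fin n) ℂ) p) =
        Polynomial.aeval (X (e i) : MvPolynomial (Fin n) ℂ) p := fun i p => by
    rw [← Polynomial.aeval_algHom_apply, rename_X]
  simp only [shiftNumerator, map_sum, map_mul, map_prod, map_intCast, rename_C, hren,
    Finset.mul_sum]
  refine Finset.sum_nbij' (Finsupp.mapDomain e) (Finsupp.mapDomain e.symm) ?_ ?_ ?_ ?_ ?_
  · intro m hm; rwa [mem_support_iff, hc, ← mem_support_iff]
  · intro m hm; rwa [mem_support_iff, hc, ← mem_support_iff]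
  · intro m _; rw [← Finsupp.mapDomain_comp]; simp
  · intro m _; rw [← Finsupp.mapDomain_comp]; simp
  · intro m _
    rw [← Equiv.sum_comp (Equiv.mulRight e)]
    refine Finset.sum_congr rfl fun w _ => ?_
    rw [hc, ← Equiv.prod_comp e fun i => Polynomial.aeval (X i : MvPolynomial (Fin n) ℂ)
      (l (w i) (Finsupp.mapDomain e m i))]
    simp only [Equiv.coe_mulRight, Equiv.Perm.sign_mul, Units.val_mul, Int.cast_mul,
      Equiv.Perm.coe_mul, Function.comp_apply, Finsupp.mapDomain_apply e.injective]
    ring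

theorem vdm_dvd_of_rename {n : ℕ} {f : MvPolynomial (Fin n) ℂ} (hf : ∀ e : Equiv.Perm (Fin n),
    rename e f = ((Equiv.Perm.sign e : ℤ) : MvPolynomial (Fin n) ℂ) * f) :
    ∃ g, g.IsSymmetric ∧ f = vdm n * g := by
  have hd : vdm n ∣ f := by
    refine vdm_dvd f fun i j hij => ?_
    -- After X_j := X_i the swap of i and j is invisible, while antisymmetry gives a sign; hence the
    -- substituted polynomial equals its own negative.
    have h : (subst j (X i)).comp (rename (Equiv.swap i j) : _ →ₐ[ℂ] _) = subst j (X i) := by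
      apply MvPolynomial.algHom_ext
      intro k
      rw [AlgHom.comp_apply, rename_X]
      rcases eq_or_ne k i with rfl | hi
      · rw [Equiv.swap_apply_left, subst_X_self, subst_X_of_ne hij.ne]
      rcases eq_or_ne k j with rfl | hj
      · rw [Equiv.swap_apply_right, subst_X_self, subst_X_of_ne hij.ne]
      · rw [Equiv.swap_apply_of_ne_of_ne hi hj]
    have h1 := DFunLike.congr_fun h f
    rw [AlgHom.comp_apply, hf, Equiv.Perm.sign_swap hij.ne] at h1
    simp only [Units.val_neg, Units.val_one, Int.cast_neg, Int.cast_one, neg_mul, one_mul,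
      map_neg] at h1
    exact self_eq_neg.mp h1.symm
  obtain ⟨g, rfl⟩ := hd
  refine ⟨g, fun e => ?_, rfl⟩
  have := hf e
  rw [map_mul, rename_vdm, mul_assoc] at this
  have hs : ((Equiv.Perm.sign e : ℤ) : MvPolynomial (Fin n) ℂ) ≠ 0 := by
    exact_mod_cast (Equiv.Perm.sign e).ne_zero
  exact mul_left_cancel₀ (vdm_ne_zero n) (mul_left_cancel₀ hs this)

/-- The `q`-difference operator with half shifts maps symmetric polynomials in `x_i + x_i⁻¹` to
symmetric polynomials of no larger degree. -/
theorem exists_shift_operator {n : ℕ} {r s : ℂ} (hr : r ≠ 0) (hs : s ≠ 0) (a u : ℂ)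
    {f : MvPolynomial (Fin n) ℂ} (hf : f.IsSymmetric) :
    ∃ g : MvPolynomial (Fin n) ℂ, g.IsSymmetric ∧ g.totalDegree ≤ f.totalDegree ∧
      ∀ x : Fin n → ℂ, (∀ i, x i ≠ 0) → (∀ i, x i ^ 2 ≠ 1) →
        (Matrix.vandermonde fun i => invSum (x i)).det * eval (fun i => invSum (x i)) g =
          ∑ b : Fin n → Bool, (∏ i, shiftCoeff a u (signPow (b i) (x i))) *
            (Matrix.vandermonde fun i => invSum (r * signPow (b i) (x i))).det *
              eval (fun i => invSum (s * signPow (b i) (x i))) f := by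
  choose l hl hl' using exists_polynomial_shift hr hs a u
  obtain ⟨g, hg, e⟩ := vdm_dvd_of_rename (rename_shiftNumerator l hf)
  refine ⟨g, hg, ?_, fun x hx hx1 => ?_⟩
  · by_cases h0 : g = 0
    · simp [h0]
    -- The shifted Vandermonde determinant raises the degree of the numerator by at most the degree
    -- of the one divided out.
    have := totalDegree_shiftNumerator_le hl f
    rw [e, totalDegree_mul_of_isDomain (vdm_ne_zero n) h0, totalDegree_vdm] at this
    omega
  · rw [← eval_vdm, ← map_mul, ← e, shiftNumerator]
    have hev : ∀ (i : Fin n) (p : Polynomial ℂ), eval (fun i => invSum (x i))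
        (Polynomial.aeval (X i : MvPolynomial (Fin n) ℂ) p) = p.eval (invSum (x i)) := by
      intro i p
      rw [← coe_aeval_eq_eval, RingHom.coe_coe, ← Polynomial.aeval_algHom_apply, aeval_X,
        Polynomial.coe_aeval_eq_eval]
    simp only [map_sum, map_mul, map_prod, map_intCast, eval_C, hev, hl' _ _ _ (hx _) (hx1 _),
      Finset.prod_univ_sum, Fintype.piFinset_univ]
    simp only [Finset.mul_sum]
    -- For a fixed monomial m of f and a fixed term w of the determinant, the sum over sign vectors
    -- b is a product of one-variable sums; bringing b outermost recovers the determinant and f.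
    rw [Finset.sum_congr rfl fun m _ => Finset.sum_comm, Finset.sum_comm]
    refine Finset.sum_congr rfl fun b _ => ?_
    rw [eval_eq', det_vandermonde_eq_sum, mul_assoc, Finset.sum_mul_sum, Finset.sum_comm,
      Finset.mul_sum]
    refine Finset.sum_congr rfl fun w _ => ?_
    rw [Finset.mul_sum]
    refine Finset.sum_congr rfl fun m _ => ?_
    simp only [Finset.prod_mul_distrib]
    ring

/-! ### The extra vanishing property -/

/-- The positive real factor of a coordinate of an interpolation point. -/
noncomputable def gridRadius {n : ℕ} (q t : ℝ) (mu : Fin n → ℕ) (i : Fin n) : ℝ :=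
  q ^ mu i * t ^ delta n i

theorem grid_eq_gridRadius_mul {n : ℕ} (q t : ℝ) (a : ℂ) (mu : Fin n → ℕ) (i : Fin n) :
    grid q t a mu i = gridRadius q t mu i * a := by
  simp [grid, gridRadius]

theorem strictMono_gridRadius {n : ℕ} {q t : ℝ} (hq : 0 < q) (hq1 : q < 1) (ht : 0 < t)
    (ht1 : t < 1) {mu : Fin n → ℕ} (hmu : IsPartition mu) : StrictMono (gridRadius q t mu) := by
  intro i j hij
  exact mul_lt_mul' (pow_le_pow_of_le_one hq.le hq1.le (hmu hij.le))
    (pow_lt_pow_right_of_lt_one₀ ht ht1 (delta_lt_delta hij)) (by positivity) (by positivity)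

/-- Otherwise the two strictly increasing families would have the same range and coincide. The index
found here allows the parameter u of the operator to separate λ from μ. -/
theorem exists_gridRadius_ne {n : ℕ} {q t : ℝ} (hq : 0 < q) (hq1 : q < 1) (ht : 0 < t)
    (ht1 : t < 1) {lam mu : Fin n → ℕ} (hlam : IsPartition lam) (hmu : IsPartition mu)
    (hne : lam ≠ mu) : ∃ i, ∀ j, gridRadius q t lam i ≠ gridRadius q t mu j := by
  by_contra! h
  have hl := strictMono_gridRadius hq hq1 ht ht1 hlam
  have hm := strictMono_gridRadius hq hq1 ht ht1 hmu
  have hr : Finset.univ.image (gridRadius q t lam) = Finset.univ.image (gridRadius q t mu) := by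
    apply Finset.eq_of_subset_of_card_le
    · intro z hz
      obtain ⟨i, -, rfl⟩ := Finset.mem_image.mp hz
      obtain ⟨j, hj⟩ := h i
      exact Finset.mem_image.mpr ⟨j, Finset.mem_univ j, hj.symm⟩
    · rw [Finset.card_image_of_injective _ hl.injective,
        Finset.card_image_of_injective _ hm.injective]
  have he : gridRadius q t lam = gridRadius q t mu := by
    apply (StrictMono.range_inj hl hm).mp
    simpa using congrArg (fun s : Finset ℝ => (s : Set ℝ)) hr
  apply hne
  funext i
  have h1 := mul_right_cancel₀ (pow_pos ht (delta n i)).ne' (congrFun he i)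
  exact (pow_right_strictAnti₀ hq hq1).injective h1

/-- Genericity of the base point including the boundary conditions. -/
def StronglyGeneric (q t : ℝ) (a : ℂ) : Prop :=
  ∀ i j : ℕ, (q : ℂ) ^ i * (t : ℂ) ^ j * a ^ 2 ≠ 1

theorem StronglyGeneric.generic {q t : ℝ} {a : ℂ} (h : StronglyGeneric q t a) : Generic q t a :=
  fun i j _ => h i j

theorem StronglyGeneric.grid_mul_grid_ne {n : ℕ} {q t : ℝ} {a : ℂ} (h : StronglyGeneric q t a)
    (mu : Fin n → ℕ) (i j : Fin n) (k : ℕ) :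
    (t : ℂ) ^ k * (grid q t a mu i * grid q t a mu j) ≠ 1 := by
  intro e
  apply h (mu i + mu j) (delta n i + delta n j + k)
  rw [← e, grid, grid]
  ring

/-- Covers both determinants of the operator: r = 1 with k = 0 for the one divided by, and r² = t
with k = 1 for the shifted one. -/
theorem det_vandermonde_invSum_ne_zero {n : ℕ} {q t : ℝ} (hq : 0 < q) (hq1 : q < 1) (ht : 0 < t)
    (ht1 : t < 1) {a : ℂ} (ha : a ≠ 0) (hgen : StronglyGeneric q t a) {mu : Fin n → ℕ}
    (hmu : IsPartition mu) {r : ℂ} {k : ℕ} (hr : r ^ 2 = (t : ℂ) ^ k) :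
    (Matrix.vandermonde fun i => invSum (r * grid q t a mu i)).det ≠ 0 := by
  have htc : (t : ℂ) ≠ 0 := by exact_mod_cast ht.ne'
  have hr0 : r ≠ 0 := by
    rintro rfl
    exact pow_ne_zero k htc (by rw [← hr]; simp)
  rw [Matrix.det_vandermonde_ne_zero_iff]
  intro i j hij
  by_contra hne
  refine invSum_ne (mul_ne_zero hr0 (grid_ne_zero hq ht ha mu i))
    (mul_ne_zero hr0 (grid_ne_zero hq ht ha mu j)) (fun e => hne ?_) ?_ hij
  · have h1 := mul_left_cancel₀ hr0 e
    rw [grid_eq_gridRadius_mul, grid_eq_gridRadius_mul] at h1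
    exact (strictMono_gridRadius hq hq1 ht ht1 hmu).injective
      (by exact_mod_cast mul_right_cancel₀ ha h1)
  · have := hgen.grid_mul_grid_ne mu i j k
    rw [← hr] at this
    intro e
    apply this
    rw [← e]; ring

theorem ne_zero_of_sq_eq_ofReal {z : ℂ} {x : ℝ} (hx : 0 < x) (h : z ^ 2 = x) : z ≠ 0 := by
  rintro rfl
  have : (x : ℂ) = 0 := by rw [← h]; simp
  exact hx.ne' (by exact_mod_cast this)

/-- A nonvanishing coefficient of the shift operator at the point of a partition belongs to the
removal of a vertical strip. -/
theorem exists_partition_of_shift_ne_zero {n : ℕ} {q t : ℝ} (ht : 0 < t) {a : ℂ}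
    (ha : a ≠ 0) {r : ℂ} (hr : r ^ 2 = t) (u : ℂ) {mu : Fin n → ℕ} (hmu : IsPartition mu)
    (b : Fin n → Bool)
    (h : (∏ i, shiftCoeff a u (signPow (b i) (grid q t a mu i))) *
      (Matrix.vandermonde fun i => invSum (r * signPow (b i) (grid q t a mu i))).det ≠ 0) :
    ∃ nu : Fin n → ℕ, IsPartition nu ∧ ∀ i, mu i = nu i + if b i then 0 else 1 := by
  have htc : (t : ℂ) ≠ 0 := by exact_mod_cast ht.ne'
  have hr0 : r ≠ 0 := ne_zero_of_sq_eq_ofReal ht hr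
  obtain ⟨h1, h2⟩ := mul_ne_zero_iff.mp h
  rcases n with _ | n
  · exact ⟨mu, hmu, fun i => i.elim0⟩
  have hanti : Antitone fun i => (mu i : ℤ) - if b i then 0 else 1 := by
    rw [Fin.antitone_iff_succ_le]
    intro i
    by_contra! hlt
    have hle : mu i.succ ≤ mu i.castSucc := hmu (Fin.castSucc_lt_succ).le
    have h3 : b i.castSucc = false ∧ b i.succ = true ∧ mu i.castSucc = mu i.succ := by
      cases hc : b i.castSucc <;> cases hs : b i.succ <;> simp [hc, hs] at hlt ⊢ <;> omega
    obtain ⟨hc, hs, he⟩ := h3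
    -- Removing a box from the upper of two equal rows only: there x_i = t x_{i+1} and r² = t, so
    -- r/x_i and r x_{i+1} are inverse to each other and two nodes coincide.
    rw [Matrix.det_vandermonde_ne_zero_iff] at h2
    refine (Fin.castSucc_lt_succ (i := i)).ne (h2 ?_)
    have hd : delta (n + 1) i.castSucc = delta (n + 1) i.succ + 1 := by
      simp only [delta, Fin.val_castSucc, Fin.val_succ]; omega
    simp only [hc, hs, signPow, if_true, Bool.false_eq_true, if_false]
    rw [← invSum_inv (r * grid q t a mu i.succ)]
    congr 1
    simp only [grid, hd, he, pow_succ, ← hr]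
    simp only [mul_inv]
    field_simp
  have hlast : 0 ≤ (mu (Fin.last n) : ℤ) - if b (Fin.last n) then 0 else 1 := by
    by_contra! hlt
    have h3 : b (Fin.last n) = false ∧ mu (Fin.last n) = 0 := by
      cases hc : b (Fin.last n) <;> simp [hc] at hlt ⊢
      · omega
      · omega
    obtain ⟨hb, h0⟩ := h3
    -- A zero last row has x = a, and the factor 1 - a/x forbids removing a box from it.
    apply Finset.prod_ne_zero_iff.mp h1 (Fin.last n) (Finset.mem_univ _)
    simp [hb, signPow, grid, h0, delta_last, shiftCoeff, ha]
  have hpos : ∀ i, 0 ≤ (mu i : ℤ) - if b i then 0 else 1 := fun i =>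
    hlast.trans (hanti (Fin.le_last i))
  refine ⟨fun i => ((mu i : ℤ) - if b i then 0 else 1).toNat, fun i j hij =>
    Int.toNat_le_toNat (hanti hij), fun i => ?_⟩
  have := hpos i
  cases hb : b i
  · simp [hb] at this ⊢
    omega
  · simp [hb]

/-- Multiplication by s = √q turns the base a into sa without changing the part; with the inversion,
s/x has the same `invSum` as x/s, which lowers the part by one. -/
theorem eval_shift_eq_gridEval {n : ℕ} {q t : ℝ} (hq : 0 < q) (a : ℂ)
    {s : ℂ} (hs : s ^ 2 = q) {mu nu : Fin n → ℕ} {b : Fin n → Bool}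
    (h : ∀ i, mu i = nu i + if b i then 0 else 1) (f : MvPolynomial (Fin n) ℂ) :
    eval (fun i => invSum (s * signPow (b i) (grid q t a mu i))) f = gridEval q t (s * a) nu f := by
  have hqc : (q : ℂ) ≠ 0 := by exact_mod_cast hq.ne'
  have hs0 : s ≠ 0 := ne_zero_of_sq_eq_ofReal hq hs
  rw [gridEval]
  congr 2
  funext i
  have hi := h i
  cases hb : b i
  · simp only [hb, Bool.false_eq_true, if_false] at hi
    simp only [signPow, Bool.false_eq_true, if_false]
    rw [← invSum_inv]
    congr 1
    simp only [grid, hi, pow_succ, ← hs, mul_inv, inv_inv]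
    field_simp
  · simp only [hb, if_true, add_zero] at hi
    simp only [signPow, if_true]
    congr 1
    simp only [grid, hi]
    ring

/-- The extra vanishing property, for generic base points. -/
theorem gridEval_eq_zero_of_not_le {n : ℕ} {q t : ℝ} (hq : 0 < q) (hq1 : q < 1) (ht : 0 < t)
    (ht1 : t < 1) {lam : Fin n → ℕ} (hlam : IsPartition lam) {a : ℂ} (ha : a ≠ 0)
    (hgen : StronglyGeneric q t a) {s : ℂ} (hs : s ^ 2 = q)
    {f : MvPolynomial (Fin n) ℂ} (hf : f.IsSymmetric) (hd : f.totalDegree ≤ weight lam)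
    (hv : ∀ mu : Fin n → ℕ, IsPartition mu → weight mu ≤ weight lam → mu ≠ lam →
      gridEval q t (s * a) mu f = 0)
    {mu : Fin n → ℕ} (hmu : IsPartition mu) (hle : ¬ lam ≤ mu) :
    gridEval q t (s * a) mu f = 0 := by
  induction hw : weight mu using Nat.strong_induction_on generalizing mu with
  | _ w ih =>
  subst hw
  have hs0 : s ≠ 0 := ne_zero_of_sq_eq_ofReal hq hs
  obtain ⟨r, hr⟩ : ∃ r : ℂ, r ^ 2 = t := IsAlgClosed.exists_pow_nat_eq _ (by norm_num)
  have hr0 : r ≠ 0 := ne_zero_of_sq_eq_ofReal ht hr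
  have hx0 : ∀ (nu : Fin n → ℕ) i, grid q t a nu i ≠ 0 := grid_ne_zero hq ht ha
  have hx1 : ∀ (nu : Fin n → ℕ) i, grid q t a nu i ^ 2 ≠ 1 := fun nu i => by
    simpa [pow_two] using hgen.grid_mul_grid_ne nu i i 0
  -- With u the inverse of the coordinate i₀ of the point of λ, the factor 1 - u x vanishes for that
  -- coordinate but for no coordinate of the point of μ.
  obtain ⟨i₀, hi₀⟩ := exists_gridRadius_ne hq hq1 ht ht1 hlam hmu fun e => hle e.le
  set u := (grid q t a lam i₀)⁻¹ with hu
  have hnu_le : ∀ {mu nu : Fin n → ℕ} {b : Fin n → Bool},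
      (∀ i, mu i = nu i + if b i then 0 else 1) → nu ≤ mu := fun h i => by
    rw [h i]; exact Nat.le_add_right _ _
  have hw_le : ∀ {mu nu : Fin n → ℕ}, nu ≤ mu → weight nu ≤ weight mu := fun h =>
    Finset.sum_le_sum fun i _ => h i
  have hall : ∀ {mu nu : Fin n → ℕ} {b : Fin n → Bool},
      (∀ i, mu i = nu i + if b i then 0 else 1) → weight mu ≤ weight nu → ∀ i, b i = true := by
    intro mu nu b h hw i
    have he := (Finset.sum_eq_sum_iff_of_le fun i _ => hnu_le h i).mp
      (le_antisymm (hw_le (hnu_le h)) hw) i (Finset.mem_univ i)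
    by_contra hb
    have := h i
    rw [if_neg hb] at this
    omega
  obtain ⟨g, hg, hgd, hge⟩ := exists_shift_operator hr0 hs0 a u hf
  have hdet : ∀ {nu : Fin n → ℕ}, IsPartition nu →
      (Matrix.vandermonde fun i => invSum (grid q t a nu i)).det ≠ 0 := fun hnu => by
    simpa using det_vandermonde_invSum_ne_zero hq hq1 ht ht1 ha hgen hnu (r := 1) (k := 0) (by simp)
  -- At ν with |ν| ≤ |λ| only the value f(λ) could contribute, which forces ν = λ with no box
  -- removed; that term is killed by the choice of u.
  have hg0 : g = 0 := by
    refine eq_zero_of_gridEval_eq_zero hq hq1 ht ht1 ha hgen.generic hg (hgd.trans hd) ?_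
    intro nu hnu hwnu
    refine (mul_eq_zero.mp ((hge _ (hx0 nu) (hx1 nu)).trans ?_)).resolve_left (hdet hnu)
    refine Finset.sum_eq_zero fun b _ => ?_
    by_contra hne
    obtain ⟨hne1, hne2⟩ := mul_ne_zero_iff.mp hne
    obtain ⟨ka, hka, hkb⟩ := exists_partition_of_shift_ne_zero ht ha hr u hnu b hne1
    rw [eval_shift_eq_gridEval hq a hs hkb] at hne2
    have hkl : ka = lam := by
      by_contra h
      exact hne2 (hv ka hka ((hw_le (hnu_le hkb)).trans hwnu) h)
    subst hkl
    have hb := hall hkb hwnu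
    have hnk : nu = ka := funext fun i => by rw [hkb i, hb i]; simp
    subst hnk
    apply Finset.prod_ne_zero_iff.mp (mul_ne_zero_iff.mp hne1).1 i₀ (Finset.mem_univ _)
    simp [hb i₀, signPow, shiftCoeff, hu, hx0]
  have h0 := hge _ (hx0 mu) (hx1 mu)
  -- Of the relation Df = 0 at μ only the unshifted term survives: all others involve smaller
  -- partitions, which cannot contain λ either.
  rw [hg0, map_zero, mul_zero, Finset.sum_eq_single fun _ => true] at h0
  · have hb : ∀ i, mu i = mu i + if (fun _ : Fin n => true) i then 0 else 1 := by simp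
    rw [eval_shift_eq_gridEval hq a hs hb] at h0
    refine (mul_eq_zero.mp h0.symm).resolve_left (mul_ne_zero ?_ ?_)
    · refine Finset.prod_ne_zero_iff.mpr fun i _ => ?_
      simp only [signPow, if_true, shiftCoeff]
      refine div_ne_zero (mul_ne_zero ?_ ?_) (sub_ne_zero.mpr (hx1 mu i).symm)
      · rw [sub_ne_zero]
        intro e
        apply hgen (mu i) (delta n i)
        rw [e, grid]; ring
      · rw [sub_ne_zero, hu]
        intro e
        apply hi₀ i
        have h2 : grid q t a lam i₀ = grid q t a mu i := by
          have := hx0 lam i₀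
          field_simp at e
          exact e
        rw [grid_eq_gridRadius_mul, grid_eq_gridRadius_mul] at h2
        exact_mod_cast mul_right_cancel₀ ha h2
    · simp only [signPow, if_true]
      exact det_vandermonde_invSum_ne_zero hq hq1 ht ht1 ha hgen hmu (k := 1) (by simpa using hr)
  · intro b _ hb
    by_contra hne
    obtain ⟨hne1, hne2⟩ := mul_ne_zero_iff.mp hne
    obtain ⟨ka, hka, hkb⟩ := exists_partition_of_shift_ne_zero ht ha hr u hmu b hne1
    rw [eval_shift_eq_gridEval hq a hs hkb] at hne2
    refine hne2 (ih (weight ka) ?_ hka (fun h => hle (h.trans (hnu_le hkb))) rfl)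
    by_contra! hlt
    exact hb (funext (hall hkb hlt))
  · simp

/-! ### Removing strong genericity by compactness -/

/-- Exponent vectors of degree at most `d`. -/
abbrev BoundedExpo (n d : ℕ) : Type := {m : Fin n → ℕ // weight m ≤ d}

noncomputable instance (n d : ℕ) : Fintype (BoundedExpo n d) := by
  have : {m : Fin n → ℕ | weight m ≤ d}.Finite := by
    refine (Set.Finite.pi' (t := fun _ : Fin n => Set.Iic d) fun _ => Set.finite_Iic d).subset ?_
    intro mu h i
    exact (Finset.single_le_sum (f := mu) (fun _ _ => Nat.zero_le _) (Finset.mem_univ i)).trans h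
  exact this.fintype

/-- The polynomial of degree at most `d` with given coefficients. -/
noncomputable def polyOfCoeffs {n d : ℕ} (v : BoundedExpo n d → ℂ) : MvPolynomial (Fin n) ℂ :=
  ∑ m, monomial (expo m.1) (v m)

theorem coeff_polyOfCoeffs {n d : ℕ} (v : BoundedExpo n d → ℂ) (k : Fin n →₀ ℕ) :
    coeff k (polyOfCoeffs v) = ∑ m, if expo m.1 = k then v m else 0 := by
  simp [polyOfCoeffs, coeff_sum, coeff_monomial]

theorem coeff_polyOfCoeffs_expo {n d : ℕ} (v : BoundedExpo n d → ℂ) (m : BoundedExpo n d) :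
    coeff (expo m.1) (polyOfCoeffs v) = v m := by
  rw [coeff_polyOfCoeffs, Finset.sum_eq_single m]
  · simp
  · intro k _ hk
    exact if_neg fun e => hk (Subtype.ext (expo_injective e))
  · simp

theorem totalDegree_polyOfCoeffs_le {n d : ℕ} (v : BoundedExpo n d → ℂ) :
    (polyOfCoeffs v).totalDegree ≤ d := by
  refine totalDegree_finsetSum_le fun m _ => totalDegree_le_of_forall fun k hk => ?_
  have := Finset.mem_singleton.mp (support_monomial_subset hk)
  subst this
  exact m.2

theorem polyOfCoeffs_coeff {n d : ℕ} {f : MvPolynomial (Fin n) ℂ} (hf : f.totalDegree ≤ d) :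
    polyOfCoeffs (fun m : BoundedExpo n d => coeff (expo m.1) f) = f := by
  ext k
  by_cases hk : weight k ≤ d
  · have := coeff_polyOfCoeffs_expo (fun m : BoundedExpo n d => coeff (expo m.1) f) ⟨k, hk⟩
    simpa [expo_coe] using this
  · push Not at hk
    rw [coeff_eq_zero_of_totalDegree_lt_sum (hf.trans_lt hk),
      coeff_eq_zero_of_totalDegree_lt_sum ((totalDegree_polyOfCoeffs_le _).trans_lt hk)]

theorem isSymmetric_iff_coeff {n : ℕ} {f : MvPolynomial (Fin n) ℂ} :
    f.IsSymmetric ↔ ∀ (e : Equiv.Perm (Fin n)) m, coeff (Finsupp.mapDomain e m) f = coeff m f := by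
  constructor
  · intro hf e m
    conv_lhs => rw [← hf e]
    exact coeff_rename_mapDomain _ e.injective _ _
  · intro h e
    ext m
    have hm : m = Finsupp.mapDomain e (Finsupp.mapDomain e.symm m) := by
      rw [← Finsupp.mapDomain_comp]; simp
    rw [hm, coeff_rename_mapDomain _ e.injective, h e]

theorem gridEval_polyOfCoeffs {n d : ℕ} (q t : ℝ) (a : ℂ) (mu : Fin n → ℕ)
    (v : BoundedExpo n d → ℂ) :
    gridEval q t a mu (polyOfCoeffs v) = ∑ m, v m * ∏ i, invSum (grid q t a mu i) ^ m.1 i := by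
  simp only [gridEval, polyOfCoeffs, map_sum, eval_monomial]
  exact Finset.sum_congr rfl fun m _ => by rw [Finsupp.prod_fintype _ _ (by simp)]; simp

theorem tendsto_gridEval_polyOfCoeffs {n d : ℕ} {q t : ℝ} (hq : 0 < q) (ht : 0 < t)
    {a : ℂ} (ha : a ≠ 0) (mu : Fin n → ℕ) {A : ℕ → ℂ} {V : ℕ → BoundedExpo n d → ℂ}
    {v : BoundedExpo n d → ℂ} (hA : Tendsto A atTop (𝓝 a)) (hV : Tendsto V atTop (𝓝 v)) :
    Tendsto (fun k => gridEval q t (A k) mu (polyOfCoeffs (V k))) atTop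
      (𝓝 (gridEval q t a mu (polyOfCoeffs v))) := by
  simp only [gridEval_polyOfCoeffs]
  refine tendsto_finsetSum _ fun m _ => ((tendsto_pi_nhds.mp hV) m).mul
    (tendsto_finsetProd _ fun i _ => Tendsto.pow ?_ _)
  have hg : Tendsto (fun k => grid q t (A k) mu i) atTop (𝓝 (grid q t a mu i)) :=
    hA.const_mul _
  exact hg.add (hg.inv₀ (grid_ne_zero hq ht ha mu i))

/-- The exceptional set is countable, each forbidden equation being quadratic in A. The factor s⁻¹
appears because the operator acts at base a while f is evaluated at base sa. -/
theorem dense_stronglyGeneric {q t : ℝ} (hq : 0 < q) (ht : 0 < t) {s : ℂ} (hs : s ≠ 0) :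
    Dense {A : ℂ | A ≠ 0 ∧ StronglyGeneric q t (s⁻¹ * A)} := by
  have hqc : (q : ℂ) ≠ 0 := by exact_mod_cast hq.ne'
  have htc : (t : ℂ) ≠ 0 := by exact_mod_cast ht.ne'
  have hc : ({0} ∪ ⋃ p : ℕ × ℕ, {A : ℂ | A ^ 2 = s ^ 2 * ((q : ℂ) ^ p.1 * (t : ℂ) ^ p.2)⁻¹}).Countable := by
    refine (Set.countable_singleton 0).union (Set.countable_iUnion fun p => Set.Finite.countable ?_)
    set c := s ^ 2 * ((q : ℂ) ^ p.1 * (t : ℂ) ^ p.2)⁻¹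
    obtain ⟨w, hw⟩ : ∃ w : ℂ, w ^ 2 = c := IsAlgClosed.exists_pow_nat_eq _ (by norm_num)
    refine (Set.toFinite {w, -w}).subset fun A hA => ?_
    have hA' : A ^ 2 = w ^ 2 := by rw [hw]; exact hA
    simpa using sq_eq_sq_iff_eq_or_eq_neg.mp hA'
  refine (hc.dense_compl ℂ).mono fun A hA => ?_
  simp only [Set.mem_compl_iff, Set.mem_union, Set.mem_singleton_iff, Set.mem_iUnion,
    Set.mem_ofPred_eq, not_or, not_exists] at hA
  refine ⟨hA.1, fun i j e => hA.2 (i, j) ?_⟩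
  field_simp at e ⊢
  rw [← e]

/-- For every nonzero base point there is a nonzero symmetric polynomial of degree at most `|λ|`
that vanishes at the points of all partitions not containing `λ`. -/
theorem exists_vanishing {n : ℕ} {q t : ℝ} (hq : 0 < q) (hq1 : q < 1) (ht : 0 < t)
    (ht1 : t < 1) {lam : Fin n → ℕ} (hlam : IsPartition lam) {a : ℂ} (ha : a ≠ 0) :
    ∃ f : MvPolynomial (Fin n) ℂ, f ≠ 0 ∧ f.IsSymmetric ∧ f.totalDegree ≤ weight lam ∧
      ∀ mu : Fin n → ℕ, IsPartition mu → ¬ lam ≤ mu → gridEval q t a mu f = 0 := by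
  obtain ⟨s, hs⟩ : ∃ s : ℂ, s ^ 2 = q := IsAlgClosed.exists_pow_nat_eq _ (by norm_num)
  have hs0 : s ≠ 0 := ne_zero_of_sq_eq_ofReal hq hs
  obtain ⟨A, hA, hAlim⟩ := mem_closure_iff_seq_limit.mp (dense_stronglyGeneric hq ht hs0 a)
  have hex : ∀ k, ∃ v : BoundedExpo n (weight lam) → ℂ, v ∈ Metric.sphere 0 1 ∧
      (polyOfCoeffs v).IsSymmetric ∧ ∀ mu : Fin n → ℕ, IsPartition mu → ¬ lam ≤ mu →
        gridEval q t (A k) mu (polyOfCoeffs v) = 0 := by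
    intro k
    obtain ⟨f, hf0, hf, hd, hv⟩ := exists_gridEval_eq_zero q t (A k) hlam
    have hAk : s * (s⁻¹ * A k) = A k := mul_inv_cancel_left₀ hs0 _
    have hext : ∀ mu : Fin n → ℕ, IsPartition mu → ¬ lam ≤ mu → gridEval q t (A k) mu f = 0 := by
      intro mu hmu hle
      rw [← hAk] at hv ⊢
      exact gridEval_eq_zero_of_not_le hq hq1 ht ht1 hlam
        (mul_ne_zero (inv_ne_zero hs0) (hA k).1) (hA k).2 hs hf hd hv hmu hle
    set w : BoundedExpo n (weight lam) → ℂ := fun m => coeff (expo m.1) f with hw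
    have hwf : polyOfCoeffs w = f := polyOfCoeffs_coeff hd
    have hw0 : w ≠ 0 := fun h => hf0 (by rw [← hwf, h]; simp [polyOfCoeffs])
    have hsm : polyOfCoeffs (((‖w‖⁻¹ : ℝ) : ℂ) • w) = ((‖w‖⁻¹ : ℝ) : ℂ) • f := by
      rw [← hwf]
      simp only [polyOfCoeffs, Finset.smul_sum, smul_monomial, Pi.smul_apply]
    refine ⟨((‖w‖⁻¹ : ℝ) : ℂ) • w, ?_, ?_, ?_⟩
    · rw [mem_sphere_zero_iff_norm, norm_smul, Complex.norm_real, norm_inv, norm_norm,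
        inv_mul_cancel₀ (norm_ne_zero_iff.mpr hw0)]
    · intro e
      rw [hsm, map_smul, hf e]
    · intro mu hmu hle
      rw [hsm, smul_eq_C_mul, map_mul, hext mu hmu hle, mul_zero]
  choose V hV hVs hVv using hex
  -- Coefficient vectors of norm 1 have a convergent subsequence with nonzero limit; symmetry and
  -- vanishing pass to the limit.
  obtain ⟨v, hv, φ, hφ, hlim⟩ := (isCompact_sphere (0 : BoundedExpo n (weight lam) → ℂ) 1).tendsto_subseq hV
  refine ⟨polyOfCoeffs v, ?_, ?_, totalDegree_polyOfCoeffs_le v, ?_⟩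
  · intro h0
    have : v = 0 := funext fun m => by
      rw [← coeff_polyOfCoeffs_expo v m, h0, coeff_zero]; rfl
    simp [this] at hv
  · rw [isSymmetric_iff_coeff]
    intro e m
    have hc : ∀ m : Fin n →₀ ℕ, Tendsto (fun k => coeff m (polyOfCoeffs (V (φ k)))) atTop
        (𝓝 (coeff m (polyOfCoeffs v))) := fun m => by
      simp only [coeff_polyOfCoeffs]
      refine tendsto_finsetSum _ fun i _ => ?_
      split_ifs
      · exact tendsto_pi_nhds.mp hlim i
      · exact tendsto_const_nhds
    refine tendsto_nhds_unique (hc _) ((hc m).congr fun k => ?_)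
    exact (isSymmetric_iff_coeff.mp (hVs (φ k)) e m).symm
  · intro mu hmu hle
    refine tendsto_nhds_unique
      (tendsto_gridEval_polyOfCoeffs hq ht ha mu (hAlim.comp hφ.tendsto_atTop) hlim)
      (tendsto_const_nhds.congr fun k => ?_)
    exact (hVv (φ k) mu hmu hle).symm

theorem not_le_of_weight_le {n : ℕ} {lam mu : Fin n → ℕ} (hw : weight mu ≤ weight lam)
    (hne : mu ≠ lam) : ¬ lam ≤ mu := by
  intro hle
  have := (Finset.sum_eq_sum_iff_of_le fun i _ => hle i).mp
    (le_antisymm (Finset.sum_le_sum fun i _ => hle i) hw)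
  exact hne (funext fun i => (this i (Finset.mem_univ i)).symm)

/-- The monic symmetric polynomial with the vanishing property, and its value at the
interpolation point of `λ`. -/
theorem exists_monic_vanishing {n : ℕ} {q t : ℝ} (hq : 0 < q) (hq1 : q < 1) (ht : 0 < t)
    (ht1 : t < 1) {lam : Fin n → ℕ} (hlam : IsPartition lam) {a : ℂ} (ha : a ≠ 0)
    (hgen : Generic q t a) :
    ∃ f : MvPolynomial (Fin n) ℂ, f.IsSymmetric ∧ f.totalDegree ≤ weight lam ∧
      coeff (expo lam) f = 1 ∧ gridEval q t a lam f = boxProd q t a lam ∧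
      ∀ mu : Fin n → ℕ, IsPartition mu → ¬ lam ≤ mu → gridEval q t a mu f = 0 := by
  obtain ⟨f, hf0, hf, hd, hv⟩ := exists_vanishing hq hq1 ht ht1 hlam ha
  have he := gridEval_eq_coeff_mul_boxProd hq hq1 ht ht1 hlam ha hgen hf hd
    fun mu hmu hw hne => hv mu hmu (not_le_of_weight_le hw hne)
  -- If this coefficient were 0, the box formula would make f vanish at λ too, hence at all points
  -- of weight at most |λ|.
  have hc : coeff (expo lam) f ≠ 0 := by
    intro hc
    refine hf0 (eq_zero_of_gridEval_eq_zero hq hq1 ht ht1 ha hgen hf hd fun mu hmu hw => ?_)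
    by_cases h : mu = lam
    · rw [h, he, hc, zero_mul]
    · exact hv mu hmu (not_le_of_weight_le hw h)
  refine ⟨(coeff (expo lam) f)⁻¹ • f, fun e => by rw [map_smul, hf e],
    (totalDegree_smul_le _ _).trans hd, ?_, ?_, fun mu hmu hle => ?_⟩
  · rw [coeff_smul, smul_eq_mul, inv_mul_cancel₀ hc]
  · rw [smul_eq_C_mul, map_mul, he, gridEval, eval_C, inv_mul_cancel_left₀ hc]
  · rw [smul_eq_C_mul, map_mul, hv mu hmu hle, mul_zero]

theorem eq_of_monic_vanishing {n : ℕ} {q t : ℝ} (hq : 0 < q) (hq1 : q < 1) (ht : 0 < t)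
    (ht1 : t < 1) {lam : Fin n → ℕ} (hlam : IsPartition lam) {a : ℂ} (ha : a ≠ 0)
    (hgen : Generic q t a) {f g : MvPolynomial (Fin n) ℂ} (hf : f.IsSymmetric) (hg : g.IsSymmetric)
    (hfd : f.totalDegree ≤ weight lam) (hgd : g.totalDegree ≤ weight lam)
    (hc : coeff (expo lam) f = coeff (expo lam) g)
    (hfv : ∀ mu : Fin n → ℕ, IsPartition mu → ¬ lam ≤ mu → gridEval q t a mu f = 0)
    (hgv : ∀ mu : Fin n → ℕ, IsPartition mu → ¬ lam ≤ mu → gridEval q t a mu g = 0) :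
    f = g := by
  rw [← sub_eq_zero]
  have hs : (f - g).IsSymmetric := fun e => by rw [map_sub, hf e, hg e]
  have hd : (f - g).totalDegree ≤ weight lam := (totalDegree_sub _ _).trans (max_le hfd hgd)
  have hv : ∀ mu : Fin n → ℕ, IsPartition mu → ¬ lam ≤ mu → gridEval q t a mu (f - g) = 0 :=
    fun mu hmu hle => by rw [map_sub, hfv mu hmu hle, hgv mu hmu hle, sub_zero]
  have he := gridEval_eq_coeff_mul_boxProd hq hq1 ht ht1 hlam ha hgen hs hd
    fun mu hmu hw hne => hv mu hmu (not_le_of_weight_le hw hne)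
  refine eq_zero_of_gridEval_eq_zero hq hq1 ht ht1 ha hgen hs hd fun mu hmu hw => ?_
  by_cases h : mu = lam
  · rw [h, he, coeff_sub, hc, sub_self, zero_mul]
  · exact hv mu hmu (not_le_of_weight_le hw h)

/-! ### Invariant Laurent polynomials as symmetric polynomials in x + 1/x -/

/-- Evaluation of Laurent polynomials as an algebra homomorphism. -/
noncomputable def evalHom {n : ℕ} (x : Fin n → ℂ) (hx : ∀ i, x i ≠ 0) : Laurent n →ₐ[ℂ] ℂ :=
  AddMonoidAlgebra.lift ℂ ℂ (Fin n → ℤ)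
    { toFun := fun m => ∏ i, x i ^ (m.toAdd i)
      map_one' := by simp
      map_mul' := fun m k => by
        simp only [toAdd_mul, Pi.add_apply, zpow_add₀ (hx _), Finset.prod_mul_distrib] }

theorem evalHom_apply {n : ℕ} (x : Fin n → ℂ) (hx : ∀ i, x i ≠ 0) (P : Laurent n) :
    evalHom x hx P = P.eval x := by
  rw [evalHom, AddMonoidAlgebra.lift_apply, Laurent.eval]
  rfl

/-- The Laurent polynomial `x_i + x_i⁻¹`. -/
noncomputable def laurentVar {n : ℕ} (i : Fin n) : Laurent n :=
  AddMonoidAlgebra.single (Pi.single i 1) 1 + AddMonoidAlgebra.single (-Pi.single i 1) 1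

/-- The substitution of `x_i + x_i⁻¹` for the variables. -/
noncomputable def toLaurent {n : ℕ} : MvPolynomial (Fin n) ℂ →ₐ[ℂ] Laurent n :=
  aeval laurentVar

theorem eval_toLaurent {n : ℕ} (x : Fin n → ℂ) (hx : ∀ i, x i ≠ 0) (f : MvPolynomial (Fin n) ℂ) :
    Laurent.eval x (toLaurent f) = eval (fun i => invSum (x i)) f := by
  have : (evalHom x hx).comp toLaurent = aeval (R := ℂ) fun i => invSum (x i) := by
    apply MvPolynomial.algHom_ext
    intro i
    have hprod : ∀ c : ℤ, ∏ j, x j ^ (Pi.single i c : Fin n → ℤ) j = x i ^ c := fun c => by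
      rw [Finset.prod_eq_single i]
      · simp
      · intro j _ hj; simp [hj]
      · simp
    simp only [AlgHom.comp_apply, toLaurent, aeval_X, laurentVar, map_add, evalHom,
      AddMonoidAlgebra.lift_single, MonoidHom.coe_mk, OneHom.coe_mk, toAdd_ofAdd, one_smul,
      ← Pi.single_neg, hprod, invSum, zpow_one, zpow_neg]
  rw [← evalHom_apply x hx, ← AlgHom.comp_apply, this, aeval_eq_eval]

theorem coeff_mapDomainAlgHom {n : ℕ} (g : (Fin n → ℤ) →+ (Fin n → ℤ)) (hg : Function.Injective g)
    (P : Laurent n) (m : Fin n → ℤ) :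
    (AddMonoidAlgebra.mapDomainAlgHom ℂ ℂ g P).coeff (g m) = P.coeff m :=
  Finsupp.mapDomain_apply hg _ _

/-- Permutation of the entries of an exponent vector. -/
def permHom {n : ℕ} (s : Equiv.Perm (Fin n)) : (Fin n → ℤ) →+ (Fin n → ℤ) where
  toFun m := m ∘ s
  map_zero' := rfl
  map_add' _ _ := rfl

/-- Change of sign of one entry of an exponent vector. -/
def flipHom {n : ℕ} (i : Fin n) : (Fin n → ℤ) →+ (Fin n → ℤ) where
  toFun m := Function.update m i (-m i)
  map_zero' := by simp
  map_add' m k := by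
    funext j
    by_cases h : j = i
    · subst h; simp; ring
    · simp [h]

theorem permHom_injective {n : ℕ} (s : Equiv.Perm (Fin n)) : Function.Injective (permHom s) :=
  s.surjective.injective_comp_right

theorem flipHom_injective {n : ℕ} (i : Fin n) : Function.Injective (flipHom i) := by
  intro m k h
  funext j
  have := congrFun h j
  by_cases hj : j = i
  · subst hj; simpa [flipHom] using this
  · simpa [flipHom, hj] using this

theorem permHom_single {n : ℕ} (s : Equiv.Perm (Fin n)) (i : Fin n) :
    permHom s (Pi.single i 1) = Pi.single (s.symm i) 1 := by
  funext j
  simp only [permHom, AddMonoidHom.coe_mk, ZeroHom.coe_mk, Function.comp_apply, Pi.single_apply,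
    Equiv.eq_symm_apply]

theorem isWInvariant_toLaurent {n : ℕ} {f : MvPolynomial (Fin n) ℂ} (hf : f.IsSymmetric) :
    (toLaurent f).IsWInvariant := by
  constructor
  · intro s m
    have h : (AddMonoidAlgebra.mapDomainAlgHom ℂ ℂ (permHom s)).comp toLaurent =
        toLaurent.comp (rename s.symm) := by
      apply MvPolynomial.algHom_ext
      intro i
      simp [toLaurent, laurentVar, permHom_single, AddMonoidAlgebra.mapDomain_add]
    have := DFunLike.congr_fun h f
    rw [AlgHom.comp_apply, AlgHom.comp_apply, hf] at this
    conv_rhs => rw [← coeff_mapDomainAlgHom (permHom s) (permHom_injective s), this]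
    rfl
  · intro i m
    have h : (AddMonoidAlgebra.mapDomainAlgHom ℂ ℂ (flipHom i)).comp toLaurent = toLaurent := by
      apply MvPolynomial.algHom_ext
      intro j
      by_cases hj : j = i
      · subst hj
        have e : flipHom j (Pi.single j 1) = -Pi.single j 1 := by
          funext k
          by_cases hk : k = j
          · subst hk; simp [flipHom]
          · simp [flipHom, hk]
        simp [toLaurent, laurentVar, e, add_comm, AddMonoidAlgebra.mapDomain_add]
      · have e : flipHom i (Pi.single j 1) = Pi.single j 1 := by
          funext k
          by_cases hk : k = i
          · subst hk; simp [flipHom, Ne.symm hj]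
          · simp [flipHom, hk]
        simp [toLaurent, laurentVar, e, AddMonoidAlgebra.mapDomain_add]
    have := DFunLike.congr_fun h f
    rw [AlgHom.comp_apply] at this
    conv_rhs => rw [← coeff_mapDomainAlgHom (flipHom i) (flipHom_injective i), this]
    rfl

theorem coeff_mul_laurentVar {n : ℕ} (P : Laurent n) (i : Fin n) (m : Fin n → ℤ) :
    (P * laurentVar i).coeff m = P.coeff (m - Pi.single i 1) + P.coeff (m + Pi.single i 1) := by
  rw [laurentVar, mul_add, AddMonoidAlgebra.coeff_add, Finsupp.add_apply,
    AddMonoidAlgebra.coeff_mul_single_apply, AddMonoidAlgebra.coeff_mul_single_apply, neg_neg,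
    mul_one, mul_one, sub_eq_add_neg]

/-- Every choice of 1/x_i instead of x_i in the expansion of ∏ (x_i + 1/x_i)^{k_i} lowers the degree
by 2, so x^k is the only monomial of degree at least |k|. -/
theorem coeff_toLaurent_monomial {n : ℕ} (N : ℕ) (k : Fin n → ℕ) (hk : weight k = N)
    (m : Fin n → ℤ) (hm : (N : ℤ) ≤ ∑ i, m i) :
    (toLaurent (monomial (expo k) 1)).coeff m = if m = fun i => (k i : ℤ) then 1 else 0 := by
  induction N generalizing k m with
  | zero =>
    have h0 : k = 0 := funext fun i => by
      simpa using (Finset.sum_eq_zero_iff.mp hk) i (Finset.mem_univ i)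
    subst h0
    have e : expo (0 : Fin n → ℕ) = 0 := by ext; simp
    rw [e, show (monomial (0 : Fin n →₀ ℕ) (1 : ℂ)) = 1 from rfl, map_one,
      AddMonoidAlgebra.one_def, AddMonoidAlgebra.coeff_single, Finsupp.single_apply]
    exact if_congr eq_comm rfl rfl
  | succ N ih =>
    obtain ⟨i, hi⟩ : ∃ i, k i ≠ 0 := by
      by_contra! h
      simp [weight, h] at hk
    have hk' : k = fun j => Function.update k i (k i - 1) j + (Pi.single i 1 : Fin n → ℕ) j := by
      funext j
      by_cases hj : j = i
      · subst hj; simp; omega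
      · simp [hj]
    set k' := Function.update k i (k i - 1) with hk'_def
    have hs : ∑ j, (Pi.single i 1 : Fin n → ℕ) j = 1 := by simp
    have hsz : ∑ j, (Pi.single i 1 : Fin n → ℤ) j = 1 := by simp
    have hw : weight k' = N := by
      rw [hk'] at hk
      simp only [weight, Finset.sum_add_distrib, hs] at hk
      simpa [weight] using hk
    have e : expo k = expo k' + Finsupp.single i 1 := by
      ext j
      conv_lhs => rw [hk']
      simp [Finsupp.single_apply, Pi.single_apply, eq_comm]
    have hmul : (monomial (expo k) (1 : ℂ)) = monomial (expo k') 1 * X i := by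
      rw [X, monomial_mul, e, one_mul]
    have hX : toLaurent (X i) = laurentVar i := aeval_X _ _
    rw [hmul, map_mul, hX, coeff_mul_laurentVar, ih k' hw, ih k' hw]
    · rw [if_neg (c := m + Pi.single i 1 = _), add_zero]
      · refine if_congr ?_ rfl rfl
        rw [sub_eq_iff_eq_add]
        have : (fun j => (k j : ℤ)) = (fun j => (k' j : ℤ)) + Pi.single i 1 := by
          funext j
          conv_lhs => rw [hk']
          by_cases hj : j = i
          · subst hj; simp
          · simp [hj]
        rw [this]
      · intro h
        have := congrArg (fun v : Fin n → ℤ => ∑ j, v j) h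
        simp only [Pi.add_apply, Finset.sum_add_distrib, hsz] at this
        rw [← Nat.cast_sum] at this
        simp only [weight] at hw
        rw [hw] at this
        push_cast at hm
        omega
    · simp only [Pi.add_apply, Finset.sum_add_distrib, hsz]
      push_cast at hm
      omega
    · simp only [Pi.sub_apply, Finset.sum_sub_distrib, hsz]
      push_cast at hm
      omega

theorem coeff_toLaurent {n : ℕ} {f : MvPolynomial (Fin n) ℂ} {m : Fin n → ℤ}
    (hm : (f.totalDegree : ℤ) ≤ ∑ i, m i) :
    (toLaurent f).coeff m = ∑ k ∈ f.support, if m = fun i => (k i : ℤ) then coeff k f else 0 := by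
  conv_lhs => rw [f.as_sum]
  rw [map_sum, AddMonoidAlgebra.coeff_sum, Finsupp.finsetSum_apply]
  refine Finset.sum_congr rfl fun k hk => ?_
  have e : monomial k (coeff k f) = coeff k f • monomial (expo ⇑k) 1 := by
    rw [expo_coe, smul_monomial, smul_eq_mul, mul_one]
  have hd : ((weight ⇑k : ℕ) : ℤ) ≤ ∑ i, m i :=
    le_trans (by exact_mod_cast sum_le_totalDegree hk) hm
  rw [e, map_smul, AddMonoidAlgebra.coeff_smul_apply, coeff_toLaurent_monomial _ _ rfl m hd]
  simp

theorem coeff_toLaurent_natCast {n : ℕ} {f : MvPolynomial (Fin n) ℂ} {k : Fin n → ℕ}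
    (hk : f.totalDegree ≤ weight k) :
    (toLaurent f).coeff (fun i => (k i : ℤ)) = coeff (expo k) f := by
  rw [coeff_toLaurent (by rw [← Nat.cast_sum]; exact_mod_cast hk)]
  have : ∀ j ∈ f.support, (if (fun i => (k i : ℤ)) = (fun i => (j i : ℤ)) then coeff j f else 0) =
      if j = expo k then coeff j f else 0 := fun j _ => if_congr ⟨fun h => by
    ext i; exact_mod_cast (congrFun h i).symm, fun h => by simp [h]⟩ rfl rfl
  rw [Finset.sum_congr rfl this, Finset.sum_ite_eq']
  split_ifs with h
  · rfl
  · exact (notMem_support_iff.mp h).symm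

theorem coeff_toLaurent_eq_zero {n : ℕ} {f : MvPolynomial (Fin n) ℂ} {m : Fin n → ℤ}
    (hm : (f.totalDegree : ℤ) ≤ ∑ i, m i) (hneg : ∀ k : Fin n → ℕ, m = (fun i => (k i : ℤ)) →
      f.totalDegree < weight k) : (toLaurent f).coeff m = 0 := by
  rw [coeff_toLaurent hm]
  refine Finset.sum_eq_zero fun k hk => if_neg fun h => ?_
  exact (hneg _ h).not_ge (sum_le_totalDegree hk)

theorem sum_update_neg {n : ℕ} (m : Fin n → ℤ) (i : Fin n) :
    ∑ j, Function.update m i (-m i) j = ∑ j, m j - 2 * m i := by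
  rw [Finset.sum_update_of_mem (Finset.mem_univ i), ← Finset.add_sum_erase _ m (Finset.mem_univ i),
    Finset.sdiff_singleton_eq_erase]
  ring

/-- Top degree exponents of an invariant Laurent polynomial are nonnegative. -/
theorem Laurent.IsWInvariant.exists_eq_natCast {n : ℕ} {P : Laurent n} (hP : P.IsWInvariant)
    {m : Fin n → ℤ} (hm : P.coeff m ≠ 0) (htop : ∀ k, P.coeff k ≠ 0 → ∑ i, k i ≤ ∑ i, m i) :
    ∃ k : Fin n → ℕ, m = fun i => (k i : ℤ) := by
  refine ⟨fun i => (m i).toNat, funext fun i => (Int.toNat_of_nonneg ?_).symm⟩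
  -- Inverting x_i changes the degree by -2 m_i, which would raise it if m_i were negative.
  have := htop (Function.update m i (-m i)) (by rwa [hP.2])
  rw [sum_update_neg] at this
  omega

theorem Laurent.IsWInvariant.sub {n : ℕ} {P Q : Laurent n} (hP : P.IsWInvariant)
    (hQ : Q.IsWInvariant) : (P - Q).IsWInvariant := by
  constructor
  · intro s m
    rw [AddMonoidAlgebra.coeff_sub, Finsupp.sub_apply, Finsupp.sub_apply, hP.1, hQ.1]
  · intro i m
    rw [AddMonoidAlgebra.coeff_sub, Finsupp.sub_apply, Finsupp.sub_apply, hP.2, hQ.2]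

/-- Subtracting the image of the top homogeneous part lowers the degree. The bound is strict so that
the induction starts with only negative degrees, where P = 0 because top exponents are nonnegative.
-/
theorem exists_toLaurent_eq_of_lt {n : ℕ} (D : ℕ) {P : Laurent n} (hP : P.IsWInvariant)
    (hD : ∀ m, P.coeff m ≠ 0 → ∑ i, m i < (D : ℤ)) :
    ∃ f : MvPolynomial (Fin n) ℂ, f.IsSymmetric ∧ (∀ k ∈ f.support, ∑ i, k i < D) ∧
      toLaurent f = P := by
  induction D generalizing P with
  | zero =>
    have hP0 : P = 0 := by
      by_contra h0
      have hne : P.coeff.support.Nonempty := by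
        rwa [Finsupp.support_nonempty_iff, Ne, AddMonoidAlgebra.coeff_eq_zero]
      obtain ⟨m, hm, hmax⟩ := Finset.exists_max_image _ (fun m : Fin n → ℤ => ∑ i, m i) hne
      have hm' := Finsupp.mem_support_iff.mp hm
      obtain ⟨k, rfl⟩ := hP.exists_eq_natCast hm' fun j hj =>
        hmax j (Finsupp.mem_support_iff.mpr hj)
      have := hD _ hm'
      rw [← Nat.cast_sum] at this
      simp only [Nat.cast_zero] at this
      omega
    exact ⟨0, fun e => map_zero _, by simp, by rw [hP0, map_zero]⟩
  | succ D ih =>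
    set f₀ : MvPolynomial (Fin n) ℂ := polyOfCoeffs fun m : BoundedExpo n D =>
      if weight m.1 = D then P.coeff (fun i => (m.1 i : ℤ)) else 0 with hf₀
    have hdeg : f₀.totalDegree ≤ D := totalDegree_polyOfCoeffs_le _
    have hcoef : ∀ k : Fin n → ℕ, coeff (expo k) f₀ =
        if weight k = D then P.coeff (fun i => (k i : ℤ)) else 0 := by
      intro k
      by_cases hk : weight k ≤ D
      · exact coeff_polyOfCoeffs_expo _ ⟨k, hk⟩
      · rw [if_neg (by omega), coeff_eq_zero_of_totalDegree_lt_sum]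
        exact hdeg.trans_lt (by simpa [weight] using hk)
    have hsym : f₀.IsSymmetric := by
      rw [isSymmetric_iff_coeff]
      intro e m
      rw [← expo_coe (Finsupp.mapDomain e m), ← expo_coe m, hcoef, hcoef, expo_coe]
      have h1 : weight ⇑(Finsupp.mapDomain e m) = weight ⇑m := by
        rw [weight, ← Equiv.sum_comp e]
        simp [weight]
      have h2 : (fun i => (m i : ℤ)) = (fun i => ((Finsupp.mapDomain e m) i : ℤ)) ∘ e := by
        funext i
        simp
      rw [h1, h2, hP.1]
    have hsub : ∀ m, (P - toLaurent f₀).coeff m ≠ 0 → ∑ i, m i < (D : ℤ) := by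
      intro m hm
      by_contra! hle
      apply hm
      rw [AddMonoidAlgebra.coeff_sub, Finsupp.sub_apply, sub_eq_zero]
      have hle' : (f₀.totalDegree : ℤ) ≤ ∑ i, m i := le_trans (by exact_mod_cast hdeg) hle
      by_cases hex : ∃ k : Fin n → ℕ, m = (fun i => (k i : ℤ)) ∧ weight k = D
      · obtain ⟨k, rfl, hk⟩ := hex
        rw [coeff_toLaurent_natCast (by omega), hcoef, if_pos hk]
      · rw [coeff_toLaurent_eq_zero hle']
        · by_contra hne
          have hmD : ∑ i, m i = D := le_antisymm (by have := hD m hne; push_cast at this; omega) hle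
          obtain ⟨k, rfl⟩ := hP.exists_eq_natCast hne fun j hj => by
            have := hD j hj
            push_cast at this
            omega
          exact hex ⟨k, rfl, by rw [← Nat.cast_sum] at hmD; exact_mod_cast hmD⟩
        · rintro k rfl
          have h1 : weight k ≠ D := fun h => hex ⟨k, rfl, h⟩
          rw [← Nat.cast_sum] at hle
          have h2 : D ≤ weight k := by exact_mod_cast hle
          omega
    obtain ⟨f₁, hf₁, hd₁, he₁⟩ := ih (hP.sub (isWInvariant_toLaurent hsym)) hsub
    refine ⟨f₀ + f₁, fun e => by rw [map_add, hsym e, hf₁ e], fun k hk => ?_, by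
      rw [map_add, he₁, add_sub_cancel]⟩
    rcases Finset.mem_union.mp (support_add hk) with h | h
    · have := sum_le_totalDegree h
      omega
    · have := hd₁ k h
      omega

theorem gridEval_eq_eval_toLaurent {n : ℕ} {q t : ℝ} (hq : 0 < q) (ht : 0 < t) {a : ℂ}
    (ha : a ≠ 0) (mu : Fin n → ℕ) (f : MvPolynomial (Fin n) ℂ) :
    (toLaurent f).eval (fun i => (q : ℂ) ^ mu i * (t : ℂ) ^ delta n i * a) =
      gridEval q t a mu f :=
  eval_toLaurent _ (grid_ne_zero hq ht ha mu) f

/-- Existence and uniqueness of the interpolation Macdonald polynomial, with its value at the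
interpolation point of `λ`. -/
theorem exists_isInterpolationMacdonald {n : ℕ} {q t : ℝ} (hq : 0 < q) (hq1 : q < 1) (ht : 0 < t)
    (ht1 : t < 1) {lam : Fin n → ℕ} (hlam : IsPartition lam) {a : ℂ} (ha : a ≠ 0)
    (hgen : Generic q t a) :
    ∃ P : Laurent n, IsInterpolationMacdonald lam q t a P ∧
      (∀ Q, IsInterpolationMacdonald lam q t a Q → Q = P) ∧
      P.eval (grid q t a lam) = boxProd q t a lam := by
  obtain ⟨f, hf, hd, hc, hval, hv⟩ := exists_monic_vanishing hq hq1 ht ht1 hlam ha hgen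
  refine ⟨toLaurent f, ⟨isWInvariant_toLaurent hf, ⟨?_, ?_⟩, ?_, ?_⟩, ?_, ?_⟩
  · refine ⟨fun i => (lam i : ℤ), ?_, by simp [weight]⟩
    simp [coeff_toLaurent_natCast hd, hc]
  · rintro _ ⟨m, hm, rfl⟩
    by_contra! hlt
    have hlt' : (f.totalDegree : ℤ) < ∑ i, m i := lt_of_le_of_lt (by exact_mod_cast hd) hlt
    refine hm (coeff_toLaurent_eq_zero hlt'.le ?_)
    rintro k rfl
    rw [← Nat.cast_sum] at hlt'
    exact_mod_cast hlt'
  · rw [coeff_toLaurent_natCast hd, hc]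
  · intro mu hmu hle
    rw [gridEval_eq_eval_toLaurent hq ht ha]
    exact hv mu hmu hle
  · intro Q hQ
    obtain ⟨g, hg, hgd, rfl⟩ := exists_toLaurent_eq_of_lt (weight lam + 1) hQ.invariant fun m hm => by
      have := hQ.degree.2 ⟨m, hm, rfl⟩
      push_cast
      exact Int.lt_add_one_of_le this
    have hgd' : g.totalDegree ≤ weight lam :=
      totalDegree_le_of_forall fun k hk => Nat.lt_succ_iff.mp (hgd k hk)
    congr 1
    refine eq_of_monic_vanishing hq hq1 ht ht1 hlam ha hgen hg hf hgd' hd ?_ ?_ hv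
    · rw [hc, ← coeff_toLaurent_natCast hgd', hQ.monic]
    · intro mu hmu hle
      rw [← gridEval_eq_eval_toLaurent hq ht ha]
      exact hQ.vanishing mu hmu hle
  · exact (eval_toLaurent _ (grid_ne_zero hq ht ha lam) f).trans hval

/-! ### The limit as q tends to 1 -/

/-- If exp(log q · (i + jτ + 2α)) = 1, the exponent is 2πik. Its imaginary part 2 log q · Im α is
independent of i and j and tends to 0, so near q = 1 necessarily k = 0, uniformly in i and j. -/
theorem eventually_generic (tau : ℝ) (alpha : ℂ)
    (hgen : ∀ i j : ℕ, 1 ≤ i → (i : ℂ) + (j : ℂ) * (tau : ℂ) + 2 * alpha ≠ 0) :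
    ∀ᶠ q : ℝ in 𝓝[<] 1, Generic q (q ^ tau) ((q : ℂ) ^ alpha) := by
  have hlim : Tendsto (fun q : ℝ => |Real.log q * (2 * alpha.im)|) (𝓝[<] 1) (𝓝 0) := by
    have h1 : Tendsto Real.log (𝓝[<] 1) (𝓝 0) := by
      have := (Real.continuousAt_log one_ne_zero).tendsto
      rw [Real.log_one] at this
      exact this.mono_left nhdsWithin_le_nhds
    simpa using (h1.mul_const (2 * alpha.im)).abs
  filter_upwards [hlim.eventually_lt_const Real.two_pi_pos, self_mem_nhdsWithin,
    nhdsWithin_le_nhds (lt_mem_nhds zero_lt_one)] with q hq hq1 hq0 i j hi he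
  have hqc : (q : ℂ) ≠ 0 := by exact_mod_cast hq0.ne'
  have hlog : Real.log q ≠ 0 := (Real.log_neg hq0 hq1).ne
  rw [Complex.ofReal_cpow hq0.le, ← Complex.cpow_natCast _ i, ← Complex.cpow_nat_mul,
    ← Complex.cpow_nat_mul, ← Complex.cpow_add _ _ hqc, ← Complex.cpow_add _ _ hqc,
    Complex.cpow_def_of_ne_zero hqc, ← Complex.ofReal_log hq0.le, Complex.exp_eq_one_iff] at he
  obtain ⟨k, hk⟩ := he
  have him := congrArg Complex.im hk
  simp only [Complex.mul_im, Complex.add_im, Complex.ofReal_re, Complex.ofReal_im,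
    Complex.natCast_re, Complex.natCast_im, Complex.intCast_re, Complex.intCast_im, Complex.I_re,
    Complex.I_im, Complex.re_ofNat, Complex.im_ofNat, Complex.mul_re] at him
  have hk0 : k = 0 := by
    have h1 : Real.log q * (2 * alpha.im) = k * (2 * Real.pi) := by
      push_cast at him
      linarith
    rw [h1, abs_mul, abs_of_pos Real.two_pi_pos] at hq
    have h2 : |(k : ℝ)| < 1 := by
      by_contra! h
      nlinarith [Real.two_pi_pos]
    exact Int.abs_lt_one_iff.mp (by exact_mod_cast h2)
  rw [hk0, Int.cast_zero, zero_mul, mul_eq_zero] at hk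
  refine hgen i j hi (hk.resolve_left (by exact_mod_cast hlog) ▸ ?_)
  push_cast
  ring

theorem tendsto_one_sub_cpow_div (c : ℂ) :
    Tendsto (fun q : ℝ => (1 - (q : ℂ) ^ c) / (1 - (q : ℂ))) (𝓝[<] 1) (𝓝 c) := by
  have h : HasDerivAt (fun z : ℂ => z ^ c) c ((1 : ℝ) : ℂ) := by
    have := (hasDerivAt_id ((1 : ℝ) : ℂ)).cpow_const (c := c) (by simp)
    simpa using this
  have h2 := (hasDerivAt_iff_tendsto_slope.mp h.comp_ofReal).mono_left
    (nhdsWithin_mono 1 fun q (hq : q < 1) => ne_of_lt hq)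
  refine h2.congr' ?_
  filter_upwards [self_mem_nhdsWithin] with q hq
  have hq' : (1 : ℂ) - q ≠ 0 := by
    rw [sub_ne_zero]; exact_mod_cast (ne_of_lt hq).symm
  have hq'' : (q : ℂ) - 1 ≠ 0 := by
    rw [← neg_sub]; exact neg_ne_zero.mpr hq'
  rw [slope_def_module, Complex.real_smul]
  push_cast
  rw [Complex.one_cpow]
  field_simp
  ring

/-- The difference factors as q^{-A} (1 - q^{A-B}) (1 - q^{A+B}), and each bracket contributes the
derivative of a power at 1. -/
theorem tendsto_invSum_cpow_sub (A B : ℂ) :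
    Tendsto (fun q : ℝ => (invSum ((q : ℂ) ^ A) - invSum ((q : ℂ) ^ B)) / (1 - (q : ℂ)) ^ 2)
      (𝓝[<] 1) (𝓝 ((A - B) * (A + B))) := by
  have h0 : Tendsto (fun q : ℝ => (q : ℂ) ^ (-A)) (𝓝[<] 1) (𝓝 1) := by
    have h1 : ContinuousAt (fun q : ℝ => (q : ℂ) ^ (-A)) 1 :=
      Complex.continuous_ofReal.continuousAt.cpow continuousAt_const (by simp)
    have := h1.tendsto
    simp only [Complex.ofReal_one, Complex.one_cpow] at this
    exact this.mono_left nhdsWithin_le_nhds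
  have := (h0.mul (tendsto_one_sub_cpow_div (A - B))).mul (tendsto_one_sub_cpow_div (A + B))
  rw [one_mul] at this
  refine this.congr' ?_
  filter_upwards [self_mem_nhdsWithin, nhdsWithin_le_nhds (lt_mem_nhds zero_lt_one)] with q hq1 hq0
  have hqc : (q : ℂ) ≠ 0 := by exact_mod_cast hq0.ne'
  have hA : (q : ℂ) ^ A ≠ 0 := by simp [Complex.cpow_eq_zero_iff, hqc]
  have hB : (q : ℂ) ^ B ≠ 0 := by simp [Complex.cpow_eq_zero_iff, hqc]
  have hq' : (1 : ℂ) - q ≠ 0 := by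
    rw [sub_ne_zero]; exact_mod_cast (ne_of_lt hq1).symm
  rw [Complex.cpow_neg, Complex.cpow_sub _ _ hqc, Complex.cpow_add _ _ hqc, invSum, invSum]
  field_simp
  ring

theorem cpow_spectralPoint {n : ℕ} {q : ℝ} (hq : 0 < q) (lam : Fin n → ℕ) (tau : ℝ) (alpha : ℂ)
    (i : Fin n) : (q : ℂ) ^ spectralPoint lam tau alpha i =
      grid q (q ^ tau) ((q : ℂ) ^ alpha) lam i := by
  have hqc : (q : ℂ) ≠ 0 := by exact_mod_cast hq.ne'
  rw [spectralPoint, grid, Complex.cpow_add _ _ hqc, Complex.cpow_add _ _ hqc,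
    Complex.cpow_natCast, Complex.cpow_mul_nat, Complex.ofReal_cpow hq.le]

/-- The limit of the coordinates subtracted in the box product. -/
noncomputable def boxShift {n : ℕ} (lam : Fin n → ℕ) (tau : ℝ) (alpha : ℂ) (j : ℕ) : ℂ :=
  ((j - 1 : ℕ) : ℂ) + (tau : ℂ) * ((n - conjPart lam j : ℕ) : ℂ) + alpha

/-- The limit of the box product. -/
noncomputable def jackBoxProd {n : ℕ} (lam : Fin n → ℕ) (tau : ℝ) (alpha : ℂ) : ℂ :=
  ∏ i, ∏ j ∈ Finset.Icc 1 (lam i), (spectralPoint lam tau alpha i - boxShift lam tau alpha j) *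
    (spectralPoint lam tau alpha i + boxShift lam tau alpha j)

theorem tendsto_boxProd {n : ℕ} (lam : Fin n → ℕ) (tau : ℝ) (alpha : ℂ) :
    Tendsto (fun q : ℝ => ((1 - (q : ℂ)) ^ (2 * weight lam))⁻¹ *
      boxProd q (q ^ tau) ((q : ℂ) ^ alpha) lam) (𝓝[<] 1) (𝓝 (jackBoxProd lam tau alpha)) := by
  have : Tendsto (fun q : ℝ => ∏ i, ∏ j ∈ Finset.Icc 1 (lam i),
      (invSum ((q : ℂ) ^ spectralPoint lam tau alpha i) -
        invSum ((q : ℂ) ^ boxShift lam tau alpha j)) / (1 - (q : ℂ)) ^ 2) (𝓝[<] 1)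
      (𝓝 (jackBoxProd lam tau alpha)) :=
    tendsto_finsetProd _ fun i _ => tendsto_finsetProd _ fun j _ => tendsto_invSum_cpow_sub _ _
  refine this.congr' ?_
  filter_upwards [nhdsWithin_le_nhds (lt_mem_nhds zero_lt_one)] with q hq
  have hqc : (q : ℂ) ≠ 0 := by exact_mod_cast hq.ne'
  have hb : boxProd q (q ^ tau) ((q : ℂ) ^ alpha) lam = ∏ i, ∏ j ∈ Finset.Icc 1 (lam i),
      (invSum ((q : ℂ) ^ spectralPoint lam tau alpha i) -
        invSum ((q : ℂ) ^ boxShift lam tau alpha j)) := by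
    refine Finset.prod_congr rfl fun i _ => Finset.prod_congr rfl fun j _ => ?_
    rw [cpow_spectralPoint hq, boxShift, Complex.cpow_add _ _ hqc, Complex.cpow_add _ _ hqc,
      Complex.cpow_natCast, Complex.cpow_mul_nat, Complex.ofReal_cpow hq.le]
  simp only [Finset.prod_div_distrib, Finset.prod_const, Nat.card_Icc, Nat.add_sub_cancel,
    Finset.prod_pow_eq_pow_sum, ← pow_mul]
  rw [hb, div_eq_inv_mul, weight, Finset.mul_sum]

theorem natCast_delta {n : ℕ} (i : Fin n) : (delta n i : ℂ) = n - pos i := by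
  have := i.2
  rw [delta, pos, Nat.cast_sub (by omega), Nat.cast_sub (by omega)]
  push_cast
  ring

theorem jackBoxProd_eq {n : ℕ} (lam : Fin n → ℕ) (tau : ℝ) (alpha : ℂ) :
    jackBoxProd lam tau alpha = ∏ i : Fin n, ∏ j ∈ Finset.Icc 1 (lam i),
      (((lam i : ℂ) - (j : ℂ) + 1 + (tau : ℂ) * ((conjPart lam j : ℂ) - pos i)) *
        (2 * alpha + (lam i : ℂ) + (j : ℂ) - 1 + (tau : ℂ) *
          ((conjPart lam j : ℂ) - pos i + 2 * ((n : ℂ) - (conjPart lam j : ℂ))))) := by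
  refine Finset.prod_congr rfl fun i _ => Finset.prod_congr rfl fun j hj => ?_
  rw [spectralPoint, boxShift, natCast_delta, Nat.cast_sub (conjPart_le lam j),
    Nat.cast_sub (Finset.mem_Icc.mp hj).1]
  push_cast
  ring

/-- Existence and uniqueness of the interpolation Macdonald polynomials close to `q = 1`, and the
limit at the spectral point. -/
theorem tendsto_rescaledMacdonald {n : ℕ} {lam : Fin n → ℕ} (hlam : IsPartition lam) {tau : ℝ}
    (htau : 0 < tau) {alpha : ℂ}
    (hgen : ∀ i j : ℕ, 1 ≤ i → (i : ℂ) + (j : ℂ) * (tau : ℂ) + 2 * alpha ≠ 0) :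
    (∀ᶠ q : ℝ in 𝓝[<] 1, ∃! P : Laurent n,
      IsInterpolationMacdonald lam q (q ^ tau) ((q : ℂ) ^ alpha) P) ∧
    Tendsto (rescaledMacdonald lam tau alpha (spectralPoint lam tau alpha)) (𝓝[<] 1)
      (𝓝 (jackBoxProd lam tau alpha)) := by
  have key : ∀ᶠ q : ℝ in 𝓝[<] 1, (∃! P : Laurent n,
      IsInterpolationMacdonald lam q (q ^ tau) ((q : ℂ) ^ alpha) P) ∧
      rescaledMacdonald lam tau alpha (spectralPoint lam tau alpha) q =
        ((1 - (q : ℂ)) ^ (2 * weight lam))⁻¹ * boxProd q (q ^ tau) ((q : ℂ) ^ alpha) lam := by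
    filter_upwards [eventually_generic tau alpha hgen, self_mem_nhdsWithin,
      nhdsWithin_le_nhds (lt_mem_nhds zero_lt_one)] with q hg hq1 hq0
    have hqc : (q : ℂ) ≠ 0 := by exact_mod_cast hq0.ne'
    have ha : (q : ℂ) ^ alpha ≠ 0 := by simp [Complex.cpow_eq_zero_iff, hqc]
    obtain ⟨P, hP, huniq, hval⟩ := exists_isInterpolationMacdonald hq0 hq1
      (Real.rpow_pos_of_pos hq0 tau) (Real.rpow_lt_one hq0.le hq1 htau) hlam ha hg
    have hex : ∃! P : Laurent n, IsInterpolationMacdonald lam q (q ^ tau) ((q : ℂ) ^ alpha) P :=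
      ⟨P, hP, huniq⟩
    refine ⟨hex, ?_⟩
    have hmac : interpolationMacdonald lam q (q ^ tau) ((q : ℂ) ^ alpha) = P := by
      rw [interpolationMacdonald, dif_pos hex]
      exact huniq _ hex.choose_spec.1
    rw [rescaledMacdonald, hmac, ← hval]
    simp only [cpow_spectralPoint hq0]
  refine ⟨key.mono fun q h => h.1, (tendsto_boxProd lam tau alpha).congr' ?_⟩
  exact key.mono fun q h => h.2.symm

/-! ### The Pochhammer form -/

theorem poch_zero (z : ℂ) : poch z 0 = 1 := by simp [poch]

theorem poch_succ (z : ℂ) (k : ℕ) : poch z (k + 1) = poch z k * (z + k) :=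
  ascPochhammer_succ_eval k z

theorem poch_succ_left (z : ℂ) (k : ℕ) : poch z (k + 1) = z * poch (z + 1) k := by
  simp [poch, ascPochhammer_succ_left, Polynomial.eval_comp]

theorem poch_ne_zero_of_forall {z : ℂ} {k : ℕ} (h : ∀ l < k, z + l ≠ 0) : poch z k ≠ 0 := by
  induction k with
  | zero => simp [poch_zero]
  | succ k ih =>
    rw [poch_succ]
    exact mul_ne_zero (ih fun l hl => h l (by omega)) (h k (by omega))

theorem ne_zero_of_poch_succ_ne_zero {z : ℂ} {k : ℕ} (h : poch z (k + 1) ≠ 0) : z ≠ 0 := by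
  rw [poch_succ_left] at h
  exact left_ne_zero_of_mul h

theorem poch_add_two (z : ℂ) (k : ℕ) : poch z (k + 2) = z * (z + 1) * poch (z + 2) k := by
  rw [poch_succ_left, poch_succ_left, add_assoc, one_add_one_eq_two, mul_assoc]

theorem poch_natCast_mul_add_one_ne_zero {tau : ℝ} (htau : 0 < tau) (d k : ℕ) :
    poch ((d : ℂ) * tau + 1) k ≠ 0 := by
  refine poch_ne_zero_of_forall fun l _ => ?_
  have : (0 : ℝ) < d * tau + 1 + l := by positivity
  exact_mod_cast this.ne'

/-- The factor of a single row in the Pochhammer form of the evaluation. -/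
noncomputable def rowFactor (tau : ℝ) (alpha : ℂ) (d m : ℕ) : ℂ :=
  poch ((d : ℂ) * tau + 1) m * poch (2 * (d : ℂ) * tau + 2 * alpha) (2 * m) /
    poch ((d : ℂ) * tau + 2 * alpha) m

/-- The factor of a pair of rows in the Pochhammer form of the evaluation. -/
noncomputable def pairFactor (tau : ℝ) (alpha : ℂ) (d e m k : ℕ) : ℂ :=
  poch (((d : ℂ) + e) * tau + 2 * alpha) (m + k) /
      poch (((d : ℂ) + e + 1) * tau + 2 * alpha) (m + k) *
    (poch (((d : ℂ) - e - 1) * tau + 1) (m - k) / poch (((d : ℂ) - e) * tau + 1) (m - k))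

/-- The Pochhammer form of the evaluation. -/
noncomputable def pochProd {n : ℕ} (lam : Fin n → ℕ) (tau : ℝ) (alpha : ℂ) : ℂ :=
  (∏ j, rowFactor tau alpha (delta n j) (lam j)) *
    ∏ i, ∏ j, if i < j then pairFactor tau alpha (delta n i) (delta n j) (lam i) (lam j) else 1

/-- The denominators of the Pochhammer form of the evaluation do not vanish. -/
def PochDenominators {n : ℕ} (lam : Fin n → ℕ) (tau : ℝ) (alpha : ℂ) : Prop :=
  (∀ j, poch ((delta n j : ℂ) * tau + 2 * alpha) (lam j) ≠ 0) ∧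
    ∀ i j, i < j → poch (((delta n i : ℂ) + delta n j + 1) * tau + 2 * alpha) (lam i + lam j) ≠ 0

/-- The genericity assumption on the parameters. -/
def GenericJack (tau : ℝ) (alpha : ℂ) : Prop :=
  ∀ i j : ℕ, 1 ≤ i → (i : ℂ) + (j : ℂ) * (tau : ℂ) + 2 * alpha ≠ 0

theorem GenericJack.add_tau {tau : ℝ} {alpha : ℂ} (h : GenericJack tau alpha) :
    GenericJack tau (alpha + tau) := by
  intro i j hi e
  apply h i (j + 2) hi
  rw [← e]; push_cast; ring

theorem GenericJack.add_one {tau : ℝ} {alpha : ℂ} (h : GenericJack tau alpha) :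
    GenericJack tau (alpha + 1) := by
  intro i j hi e
  apply h (i + 2) j (by omega)
  rw [← e]; push_cast; ring

theorem jackBoxProd_snocZero {n : ℕ} (mu : Fin n → ℕ) (tau : ℝ) (alpha : ℂ) :
    jackBoxProd (snocZero mu) tau alpha = jackBoxProd mu tau (alpha + tau) := by
  simp only [jackBoxProd, Fin.prod_univ_castSucc, snocZero_castSucc, snocZero_last]
  rw [Finset.Icc_eq_empty (by omega), Finset.prod_empty, mul_one]
  refine Finset.prod_congr rfl fun i _ => Finset.prod_congr rfl fun j hj => ?_
  have hB : boxShift (snocZero mu) tau alpha j = boxShift mu tau (alpha + tau) j := by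
    rw [boxShift, boxShift, conjPart_snocZero mu (Finset.mem_Icc.mp hj).1,
      Nat.succ_sub (conjPart_le mu j)]
    push_cast
    ring
  have hA : spectralPoint (snocZero mu) tau alpha i.castSucc =
      spectralPoint mu tau (alpha + tau) i := by
    rw [spectralPoint, spectralPoint, delta_castSucc, snocZero_castSucc]
    push_cast
    ring
  rw [hA, hB]

theorem jackBoxProd_add_one {n : ℕ} (mu : Fin n → ℕ) (tau : ℝ) (alpha : ℂ) :
    jackBoxProd (fun i => mu i + 1) tau alpha =
      (∏ i, ((delta n i : ℂ) * tau + 1 + mu i) * ((delta n i : ℂ) * tau + 2 * alpha + mu i + 1)) *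
        jackBoxProd mu tau (alpha + 1) := by
  simp only [jackBoxProd, prod_Icc_one_succ]
  rw [Finset.prod_mul_distrib]
  congr 1
  · refine Finset.prod_congr rfl fun i _ => ?_
    rw [spectralPoint, boxShift, conjPart_add_one_one]
    push_cast
    simp only [Nat.sub_self, Nat.cast_zero]
    ring
  · refine Finset.prod_congr rfl fun i _ => Finset.prod_congr rfl fun j hj => ?_
    obtain ⟨k, rfl⟩ := Nat.exists_eq_add_of_le (Finset.mem_Icc.mp hj).1
    rw [spectralPoint, boxShift, conjPart_add_one, spectralPoint, boxShift]
    simp only [Nat.add_sub_cancel_left, Nat.add_sub_cancel]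
    push_cast
    ring

/-- Interaction with an appended zero row turns the row factor at α into the one at α + τ. -/
theorem rowFactor_mul_pairFactor {tau : ℝ} (htau : 0 < tau) {alpha : ℂ} (d m : ℕ)
    (h : poch (((d + 1 : ℕ) : ℂ) * tau + 2 * alpha) m ≠ 0) :
    rowFactor tau alpha (d + 1) m * pairFactor tau alpha (d + 1) 0 m 0 =
      rowFactor tau (alpha + tau) d m := by
  have h1 := poch_natCast_mul_add_one_ne_zero htau (d + 1) m
  simp only [rowFactor, pairFactor, Nat.sub_zero, Nat.cast_zero, add_zero, sub_zero]
  rw [show (((d + 1 : ℕ) : ℂ) - 1) * tau + 1 = (d : ℂ) * tau + 1 by push_cast; ring,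
    show 2 * ((d + 1 : ℕ) : ℂ) * tau + 2 * alpha = 2 * (d : ℂ) * tau + 2 * (alpha + tau) by
      push_cast; ring,
    show (((d + 1 : ℕ) : ℂ) + 1) * tau + 2 * alpha = (d : ℂ) * tau + 2 * (alpha + tau) by
      push_cast; ring]
  field_simp

theorem pairFactor_succ_succ (tau : ℝ) (alpha : ℂ) (d e m k : ℕ) :
    pairFactor tau alpha (d + 1) (e + 1) m k = pairFactor tau (alpha + tau) d e m k := by
  simp only [pairFactor]
  rw [show (((d + 1 : ℕ) : ℂ) + (e + 1 : ℕ)) * tau + 2 * alpha =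
      ((d : ℂ) + e) * tau + 2 * (alpha + tau) by push_cast; ring,
    show (((d + 1 : ℕ) : ℂ) + (e + 1 : ℕ) + 1) * tau + 2 * alpha =
      ((d : ℂ) + e + 1) * tau + 2 * (alpha + tau) by push_cast; ring,
    show (((d + 1 : ℕ) : ℂ) - (e + 1 : ℕ)) = (d : ℂ) - e by push_cast; ring]

theorem pochProd_snocZero {n : ℕ} (mu : Fin n → ℕ) {tau : ℝ} (htau : 0 < tau) {alpha : ℂ}
    (h : PochDenominators (snocZero mu) tau alpha) :
    pochProd (snocZero mu) tau alpha = pochProd mu tau (alpha + tau) := by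
  have hrow : ∀ i : Fin n, rowFactor tau alpha (delta n i + 1) (mu i) *
      pairFactor tau alpha (delta n i + 1) 0 (mu i) 0 =
        rowFactor tau (alpha + tau) (delta n i) (mu i) := fun i =>
    rowFactor_mul_pairFactor htau _ _ (by simpa [delta_castSucc] using h.1 i.castSucc)
  have hlast : rowFactor tau alpha 0 0 = 1 := by simp [rowFactor, poch_zero]
  simp only [pochProd, Fin.prod_univ_castSucc, snocZero_castSucc, snocZero_last, delta_castSucc,
    delta_last, Fin.castSucc_lt_castSucc_iff, Fin.castSucc_lt_last, if_true, lt_irrefl, if_false,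
    hlast, mul_one, Finset.prod_mul_distrib, pairFactor_succ_succ]
  rw [← Finset.prod_congr rfl fun i _ => hrow i, Finset.prod_mul_distrib]
  have : ∀ i : Fin n, ¬ Fin.last n < i.castSucc := fun i => (Fin.castSucc_lt_last i).not_gt
  simp only [this, if_false, Finset.prod_const_one, mul_one]
  ring

/-- The row denominators at α + τ are the old pair denominators with the zero row. -/
theorem PochDenominators.of_snocZero {n : ℕ} {mu : Fin n → ℕ} {tau : ℝ} {alpha : ℂ}
    (h : PochDenominators (snocZero mu) tau alpha) : PochDenominators mu tau (alpha + tau) := by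
  constructor
  · intro j
    have := h.2 j.castSucc (Fin.last n) (Fin.castSucc_lt_last j)
    rw [snocZero_castSucc, snocZero_last, delta_castSucc, delta_last] at this
    convert this using 2
    · push_cast
      ring
    · rfl
  · intro i j hij
    have := h.2 i.castSucc j.castSucc (Fin.castSucc_lt_castSucc_iff.mpr hij)
    rw [snocZero_castSucc, snocZero_castSucc, delta_castSucc, delta_castSucc] at this
    convert this using 2
    push_cast
    ring

theorem poch_ne_zero_of_genericJack {tau : ℝ} {alpha : ℂ} (h : GenericJack tau alpha) (d k : ℕ) :
    poch ((d : ℂ) * tau + 2 * (alpha + 1)) k ≠ 0 := by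
  refine poch_ne_zero_of_forall fun l _ e => h (l + 2) d (by omega) ?_
  rw [← e]; push_cast; ring

theorem PochDenominators.of_genericJack {n : ℕ} (mu : Fin n → ℕ) {tau : ℝ} {alpha : ℂ}
    (h : GenericJack tau alpha) : PochDenominators mu tau (alpha + 1) := by
  constructor
  · intro j
    exact poch_ne_zero_of_genericJack h _ _
  · intro i j _
    simpa using poch_ne_zero_of_genericJack h (delta n i + delta n j + 1) (mu i + mu j)

/-- The quadratic factor lost by the Pochhammer symbols when a column is removed. -/
noncomputable def edgeFactor (tau : ℝ) (alpha : ℂ) (d : ℕ) : ℂ :=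
  ((d : ℂ) * tau + 2 * alpha) * ((d : ℂ) * tau + 2 * alpha + 1)

theorem edgeFactor_ne_zero {tau : ℝ} {alpha : ℂ} (h : GenericJack tau alpha) {d : ℕ}
    (hd : (d : ℂ) * tau + 2 * alpha ≠ 0) : edgeFactor tau alpha d ≠ 0 := by
  refine mul_ne_zero hd fun e => h 1 d le_rfl ?_
  rw [← e]; push_cast; ring

theorem rowFactor_succ {tau : ℝ} {alpha : ℂ} (h : GenericJack tau alpha) (d m : ℕ)
    (hd : poch ((d : ℂ) * tau + 2 * alpha) (m + 1) ≠ 0) :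
    rowFactor tau alpha d (m + 1) =
      ((d : ℂ) * tau + 1 + m) * ((d : ℂ) * tau + 2 * alpha + m + 1) *
        rowFactor tau (alpha + 1) d m * (edgeFactor tau alpha (2 * d) / edgeFactor tau alpha d) := by
  have he : edgeFactor tau alpha d ≠ 0 := edgeFactor_ne_zero h (ne_zero_of_poch_succ_ne_zero hd)
  have hp := poch_ne_zero_of_genericJack h d m
  have h2 : poch ((d : ℂ) * tau + 2 * alpha) (m + 1) * ((d : ℂ) * tau + 2 * alpha + m + 1) =
      edgeFactor tau alpha d * poch ((d : ℂ) * tau + 2 * (alpha + 1)) m := by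
    have := poch_succ ((d : ℂ) * tau + 2 * alpha) (m + 1)
    rw [poch_add_two] at this
    rw [edgeFactor, show (d : ℂ) * tau + 2 * (alpha + 1) = (d : ℂ) * tau + 2 * alpha + 2 by ring,
      this]
    push_cast
    ring
  have h3 : poch (2 * (d : ℂ) * tau + 2 * alpha) (2 * (m + 1)) =
      edgeFactor tau alpha (2 * d) * poch (2 * (d : ℂ) * tau + 2 * (alpha + 1)) (2 * m) := by
    rw [show 2 * (m + 1) = 2 * m + 2 by ring, poch_add_two, edgeFactor,
      show 2 * (d : ℂ) * tau + 2 * (alpha + 1) = 2 * (d : ℂ) * tau + 2 * alpha + 2 by ring]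
    push_cast
    ring
  rw [rowFactor, rowFactor, poch_succ _ m, h3, div_eq_iff hd]
  generalize poch ((d : ℂ) * tau + 2 * alpha) (m + 1) = A at *
  rw [show ∀ x y z w e f : ℂ, x * y * (z / w) * (e / f) * A = A * y * x * z * e / (w * f) by
    intros; ring, h2]
  field_simp

/-- The difference of the two rows is unchanged and their sum grows by 2, so only the first quotient
of Pochhammer symbols sheds factors. The quotient identity also holds when denominators vanish, with
division by 0 equal to 0. -/
theorem pairFactor_succ_row {tau : ℝ} {alpha : ℂ} (d e m k : ℕ) :
    pairFactor tau alpha d e (m + 1) (k + 1) =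
      pairFactor tau (alpha + 1) d e m k *
        (edgeFactor tau alpha (d + e) / edgeFactor tau alpha (d + e + 1)) := by
  have h3 : ∀ c j : ℕ, poch ((c : ℂ) * tau + 2 * alpha) (j + 2) =
      edgeFactor tau alpha c * poch ((c : ℂ) * tau + 2 * (alpha + 1)) j := fun c j => by
    rw [poch_add_two, edgeFactor,
      show (c : ℂ) * tau + 2 * (alpha + 1) = (c : ℂ) * tau + 2 * alpha + 2 by ring]
  have h4 := h3 (d + e) (m + k)
  have h5 := h3 (d + e + 1) (m + k)
  push_cast at h4 h5
  rw [pairFactor, pairFactor, show m + 1 + (k + 1) = m + k + 2 by ring, h4, h5,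
    Nat.add_sub_add_right, mul_div_mul_comm]
  ring

theorem prod_delta_gt {n : ℕ} (H : ℕ → ℂ) (i : Fin n) :
    (∏ j, if i < j then H (delta n j) else 1) = ∏ l ∈ Finset.range (delta n i), H l := by
  rw [← Finset.prod_filter]
  refine Finset.prod_nbij (delta n) ?_ ?_ ?_ fun _ _ => rfl
  · intro j hj
    exact Finset.mem_range.mpr (delta_lt_delta (Finset.mem_filter.mp hj).2)
  · intro j _ k _ h
    have := j.2
    have := k.2
    simp only [delta] at h
    exact Fin.ext (by omega)
  · intro l hl
    have hl' : l < delta n i := by simpa using hl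
    have hi := i.2
    simp only [delta] at hl'
    refine ⟨⟨n - 1 - l, by omega⟩, ?_, ?_⟩
    · refine Finset.mem_coe.mpr (Finset.mem_filter.mpr ⟨Finset.mem_univ _, ?_⟩)
      rw [Fin.lt_def]
      dsimp only
      omega
    · simp only [delta]; omega

theorem prod_range_div_succ (g : ℕ → ℂ) (K : ℕ) (h : ∀ l ≤ K, g l ≠ 0) :
    ∏ l ∈ Finset.range K, g l / g (l + 1) = g 0 / g K := by
  induction K with
  | zero => simp [h 0 le_rfl]
  | succ K ih =>
    have := h K (by omega)
    rw [Finset.prod_range_succ, ih fun l hl => h l (by omega)]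
    field_simp

theorem pochProd_add_one {n : ℕ} (mu : Fin n → ℕ) {tau : ℝ} {alpha : ℂ}
    (hg : GenericJack tau alpha) (h : PochDenominators (fun i => mu i + 1) tau alpha) :
    pochProd (fun i => mu i + 1) tau alpha =
      (∏ i, ((delta n i : ℂ) * tau + 1 + mu i) * ((delta n i : ℂ) * tau + 2 * alpha + mu i + 1)) *
        pochProd mu tau (alpha + 1) := by
  -- For d = δ_i, the rows below i have δ_j = 0, …, d-1; the product of E(d+l)/E(d+l+1) over these l
  -- telescopes to E(d)/E(2d), cancelling the leftover of the row factor.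
  have htel : ∀ i : Fin n, edgeFactor tau alpha (2 * delta n i) / edgeFactor tau alpha (delta n i) *
      (∏ j, if i < j then edgeFactor tau alpha (delta n i + delta n j) /
        edgeFactor tau alpha (delta n i + delta n j + 1) else 1) = 1 := by
    intro i
    -- The row denominator covers l = 0; for l ≥ 1 the pair denominator with the row of δ_j = l - 1
    -- does.
    have hne : ∀ l ≤ delta n i, edgeFactor tau alpha (delta n i + l) ≠ 0 := by
      intro l hl
      apply edgeFactor_ne_zero hg
      rcases l with _ | l
      · exact ne_zero_of_poch_succ_ne_zero (h.1 i)
      · have hi := i.2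
        simp only [delta] at hl
        have hlt : i < (⟨n - 1 - l, by omega⟩ : Fin n) := by
          rw [Fin.lt_def]
          dsimp only
          omega
        have hd : delta n ⟨n - 1 - l, by omega⟩ = l := by simp only [delta]; omega
        have := h.2 i _ hlt
        rw [hd] at this
        have h1 : poch (((delta n i + (l + 1) : ℕ) : ℂ) * tau + 2 * alpha)
            (mu i + 1 + mu ⟨n - 1 - l, by omega⟩ + 1) ≠ 0 := by
          rw [show ((delta n i + (l + 1) : ℕ) : ℂ) = (delta n i : ℂ) + l + 1 by push_cast; ring]
          exact this
        exact ne_zero_of_poch_succ_ne_zero h1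
    have h3 : ∏ l ∈ Finset.range (delta n i), edgeFactor tau alpha (delta n i + l) /
        edgeFactor tau alpha (delta n i + l + 1) =
        edgeFactor tau alpha (delta n i) / edgeFactor tau alpha (delta n i + delta n i) :=
      prod_range_div_succ (fun l => edgeFactor tau alpha (delta n i + l)) _ hne
    rw [prod_delta_gt (fun l => edgeFactor tau alpha (delta n i + l) /
      edgeFactor tau alpha (delta n i + l + 1)) i, h3, two_mul]
    have h1 := hne 0 (Nat.zero_le _)
    have h2 := hne _ le_rfl
    rw [Nat.add_zero] at h1
    field_simp
  have hpair : ∀ i j : Fin n, (if i < j then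
      pairFactor tau alpha (delta n i) (delta n j) (mu i + 1) (mu j + 1) else 1) =
      (if i < j then pairFactor tau (alpha + 1) (delta n i) (delta n j) (mu i) (mu j) else 1) *
      (if i < j then edgeFactor tau alpha (delta n i + delta n j) /
        edgeFactor tau alpha (delta n i + delta n j + 1) else 1) := fun i j => by
    split_ifs
    · exact pairFactor_succ_row ..
    · simp
  have hprod := Finset.prod_congr (rfl : (Finset.univ : Finset (Fin n)) = _) fun i _ => htel i
  rw [Finset.prod_mul_distrib, Finset.prod_const_one] at hprod
  simp only [pochProd, hpair, rowFactor_succ hg _ _ (h.1 _)]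
  simp only [Finset.prod_mul_distrib] at hprod ⊢
  linear_combination (∏ i, ((delta n i : ℂ) * tau + 1 + mu i)) *
    (∏ i, ((delta n i : ℂ) * tau + 2 * alpha + mu i + 1)) *
    (∏ j, rowFactor tau (alpha + 1) (delta n j) (mu j)) *
    (∏ i, ∏ j, if i < j then pairFactor tau (alpha + 1) (delta n i) (delta n j) (mu i) (mu j)
      else 1) * hprod

/-- The box product equals the product of Pochhammer symbols. -/
theorem jackBoxProd_eq_pochProd {n : ℕ} {lam : Fin n → ℕ} (hlam : IsPartition lam) {tau : ℝ}
    (htau : 0 < tau) {alpha : ℂ} (hg : GenericJack tau alpha)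
    (h : PochDenominators lam tau alpha) :
    jackBoxProd lam tau alpha = pochProd lam tau alpha := by
  induction n, lam, hlam using partition_induction generalizing alpha with
  | nil mu hmu => simp [jackBoxProd, pochProd]
  | snoc n mu hmu ih =>
    rw [jackBoxProd_snocZero, pochProd_snocZero mu htau h, ih hg.add_tau h.of_snocZero]
  | column n mu hmu ih =>
    rw [jackBoxProd_add_one, pochProd_add_one mu hg h,
      ih hg.add_one (PochDenominators.of_genericJack mu hg)]

end BCInterpolation

open BCInterpolation in
theorem mainTheorem5 (n : ℕ) (hn : 1 ≤ n) (lam : Fin n → ℕ) (hlam : IsPartition lam)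
    (tau : ℝ) (htau : 0 < tau) (alpha : ℂ)
    (hgen : ∀ i j : ℕ, 1 ≤ i → (i : ℂ) + (j : ℂ) * (tau : ℂ) + 2 * alpha ≠ 0) :
    -- the interpolation Macdonald polynomials and the limit at the point in question exist
    (∀ᶠ q : ℝ in 𝓝[<] 1, ∃! P : Laurent n,
      IsInterpolationMacdonald lam q (q ^ tau) ((q : ℂ) ^ alpha) P) ∧
    Tendsto (rescaledMacdonald lam tau alpha (spectralPoint lam tau alpha)) (𝓝[<] 1)
      (𝓝 (interpolationJack lam tau alpha (spectralPoint lam tau alpha))) ∧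
    -- the product over the boxes of the diagram
    interpolationJack lam tau alpha (spectralPoint lam tau alpha) =
      ∏ i : Fin n, ∏ j ∈ Finset.Icc 1 (lam i),
        (((lam i : ℂ) - (j : ℂ) + 1 + (tau : ℂ) * ((conjPart lam j : ℂ) - pos i)) *
          (2 * alpha + (lam i : ℂ) + (j : ℂ) - 1 + (tau : ℂ) *
            ((conjPart lam j : ℂ) - pos i + 2 * ((n : ℂ) - (conjPart lam j : ℂ))))) ∧
    -- the product of Pochhammer symbols, where no denominator vanishes
    ((∀ j : Fin n, poch (((n : ℂ) - pos j) * (tau : ℂ) + 2 * alpha) (lam j) ≠ 0) →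
      (∀ i j : Fin n, i < j →
        poch ((2 * (n : ℂ) - pos i - pos j + 1) * (tau : ℂ) + 2 * alpha) (lam i + lam j) ≠ 0) →
      interpolationJack lam tau alpha (spectralPoint lam tau alpha) =
        (∏ j : Fin n,
          poch (((n : ℂ) - pos j) * (tau : ℂ) + 1) (lam j) *
              poch (2 * ((n : ℂ) - pos j) * (tau : ℂ) + 2 * alpha) (2 * lam j) /
            poch (((n : ℂ) - pos j) * (tau : ℂ) + 2 * alpha) (lam j)) *
        ∏ i : Fin n, ∏ j ∈ Finset.univ.filter (fun j : Fin n => i < j),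
          (poch ((2 * (n : ℂ) - pos i - pos j) * (tau : ℂ) + 2 * alpha) (lam i + lam j) /
              poch ((2 * (n : ℂ) - pos i - pos j + 1) * (tau : ℂ) + 2 * alpha)
                (lam i + lam j)) *
            (poch ((pos j - pos i - 1) * (tau : ℂ) + 1) (lam i - lam j) /
              poch ((pos j - pos i) * (tau : ℂ) + 1) (lam i - lam j))) := by
  obtain ⟨hex, hlim⟩ := tendsto_rescaledMacdonald hlam htau hgen
  -- `limUnder` is meaningful only because the convergence is already known.
  have hval : interpolationJack lam tau alpha (spectralPoint lam tau alpha) =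
      jackBoxProd lam tau alpha := hlim.limUnder_eq
  refine ⟨hex, by rwa [hval], by rw [hval, jackBoxProd_eq], fun h1 h2 => ?_⟩
  have hd : PochDenominators lam tau alpha := by
    refine ⟨fun j => by rw [natCast_delta]; exact h1 j, fun i j hij => ?_⟩
    rw [natCast_delta, natCast_delta,
      show (n : ℂ) - pos i + (n - pos j) + 1 = 2 * n - pos i - pos j + 1 by ring]
    exact h2 i j hij
  rw [hval, jackBoxProd_eq_pochProd hlam htau hgen hd, pochProd]
  simp only [Finset.prod_filter, rowFactor, pairFactor, natCast_delta]
  congr 1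
  refine Finset.prod_congr rfl fun i _ => Finset.prod_congr rfl fun j _ => ?_
  rw [show (n : ℂ) - pos i + (n - pos j) = 2 * n - pos i - pos j by ring,
    show (n : ℂ) - pos i - (n - pos j) = pos j - pos i by ring]
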